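/- **Problem.** Consider the two-stage robust problem $$w^*=\min_{\mathbf x\in\mathcal X}\ \mathbf c_1\mathbf x+\max_{\mathbf u\in\mathcal U(\mathbf x)}\ \min_{\mathbf y\in\mathcal Y(\mathbf x,\mathbf u)}\mathbf c_2\mathbf y ,$$ $\mathcal X=\{\mathbf x\in\mathbb R_+^{n_x}\times\mathbb Z_+^{m_x}:\mathbf A\mathbf x\ge\mathbf b\}$, $\mathcal U(\mathbf x)=\{(\mathbf u_c,\mathbf u_d)\in\mathbb R_+^{n_u}\times\mathbb U_d:\mathbf F_c\mathbf u_c+\mathbf F_d\mathbf u_d\le\mathbf h+\mathbf G\mathbf x\}$ with $\mathbb U_d\subseteq\mathbb Z_+^{m_u}$ finite and $\mu_u$ inequality constraints, and $\mathcal Y(\mathbf x,\mathbf u)=\{\mathbf y\in\mathbb R_+^{n_y}:\mathbf B_2\mathbf y\ge\mathbf d-\mathbf B_1\mathbf x-\mathbf E_c\mathbf u_c-\mathbf E_d\mathbf u_d\}$. The decision dependence is of right-hand-side type, i.e. $\mathbf F_c,\mathbf F_d$ do not depend on $\mathbf x$. Assume that for every $\mathbf x\in\mathcal X$ the set $\mathcal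 U(\mathbf x)$ is nonempty and bounded, and that $\mathbf c_1\mathbf x+\mathbf c_2\mathbf y$ is bounded below over $\mathbf x\in\mathcal X,\ \mathbf u\in\mathcal U(\mathbf x),\ \mathbf y\in\mathcal Y(\mathbf x,\mathbf u)$. **Notation.** Let $\Pi=\{\pi\ge 0:\mathbf B_2^{\top}\pi\le\mathbf c_2^{\top}\}$, $\mathcal P_\Pi$ its extreme points and $\mathcal R_\Pi$ its extreme rays (generators normalized to coordinate sum $1$). For $M>0$, $\mathbf u_d\in\mathbb U_d$ and $\beta\in\mathcal P_\Pi\cup\mathcal R_\Pi$ let $\mathbf{LP}(\mathbf x,\mathbf u_d,\beta)$ be $$\max\{-(\mathbf E_c\mathbf u_c)^{\top}\beta-M\mathbf 1^{\top}\tilde{\mathbf u}:\ \mathbf F_c\mathbf u_c-\tilde{\mathbf u}\le\mathbf h+\mathbf G\mathbf x-\mathbf F_d\mathbf u_d,\ \mathbf u_c\ge 0,\ \tilde{\mathbf u}\ge 0\},$$ and let $\mathcal{OU}(\mathbf x,\mathbf u_d,\beta)$ be the solution set, in $(\mathbf u_c,\tilde{\mathbf u},\lambda)$, of its KKT conditions.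 A basis is a set of $\mu_u$ linearly independent columns of $[\mathbf F_c\ \ \mathbf I]$ (structural and slack columns; $\tilde{\mathbf u}$ is nonbasic). It is optimal for $\mathbf{LP}(\mathbf x,\mathbf u_d,\beta)$ if it is primal and dual feasible. **Algorithm** (parametric C\&CG-MIU, zero tolerance, no initial cuts, unified cutting sets). Put $UB=+\infty$. In iteration $t=1,2,\dots$: let $D_t$ be the set of pairs $(\mathbf u_d,\beta)$ generated in iterations $1,\dots,t-1$. The master problem of iteration $t$ minimizes $\mathbf c_1\mathbf x+\eta$ ($\eta\in[-\infty,\infty]$) over $\mathbf x\in\mathcal X$ and, for every $(\mathbf u_d,\beta)\in D_t$, variables $(\mathbf u_c,\tilde{\mathbf u},\lambda)\in\mathcal{OU}(\mathbf x,\mathbf u_d,\beta)$ and $\mathbf y\ge 0$ such that $\eta\ge\mathbf c_2\mathbf y$ and $\mathbf y\in\mathcal Y(\mathbf x,(\mathbf u_c,\mathbf u_d))$ whenever $\tilde{\mathbf u}=0$. If it is infeasible, report infeasibility and terminate. Otherwise take an optimal solution, with $\mathbf x$-part $\mathbf x^t$, and let $LB$ be the optimal value. Solve $\eta_f(\mathbf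 x^t)=\max_{\mathbf u\in\mathcal U(\mathbf x^t)}\min\{\mathbf 1^{\top}\tilde{\mathbf y}:\mathbf B_2\mathbf y+\tilde{\mathbf y}\ge\mathbf d-\mathbf B_1\mathbf x^t-\mathbf E_c\mathbf u_c-\mathbf E_d\mathbf u_d,\ \mathbf y,\tilde{\mathbf y}\ge 0\}$. If $\eta_f(\mathbf x^t)=0$, let $\mathbf u^*$ be a worst case scenario of $\eta_o=\max_{\mathbf u\in\mathcal U(\mathbf x^t)}\min_{\mathbf y\in\mathcal Y(\mathbf x^t,\mathbf u)}\mathbf c_2\mathbf y$ and $\beta^*\in\mathcal P_\Pi$ an optimal dual solution of the recourse problem at $\mathbf u^*$. If $\eta_f(\mathbf x^t)>0$, put $\eta_o=+\infty$, let $\mathbf u^*$ attain $\eta_f(\mathbf x^t)$ and let $\beta^*\in\mathcal R_\Pi$ satisfy $(\mathbf d-\mathbf B_1\mathbf x^t-\mathbf E_c\mathbf u_c^*-\mathbf E_d\mathbf u_d^*)^{\top}\beta^*>0$. Generate the pair $(\mathbf u_d^*,\beta^*)$, set $UB:=\min\{UB,\mathbf c_1\mathbf x^t+\eta_o\}$,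 and terminate if $UB\le LB$. **Scenarios and bases.** Let $\hat{\mathbb U}_d^t$ be the set of discrete scenarios $\mathbf u_d$ in the master problem of iteration $t$. For each $(\mathbf u_d,\beta)\in D_t$ whose $\tilde{\mathbf u}$ vanishes in the optimal master solution of iteration $t$, a nonempty family of (for example, one) optimal bases of $\mathbf{LP}(\mathbf x^t,\mathbf u_d,\beta)$ is recorded whose basic solution is the point of $\mathcal{OU}(\mathbf x^t,\mathbf u_d,\beta)$ in that master solution (in particular these points are basic solutions, in the iterations where bases are recorded). Let $\mathfrak B^t_{\mathbf u_d}$ be the collection of the bases so recorded for $\mathbf u_d$. **Theorem.** For all sufficiently large $M$ (depending only on the data of the problem): (i) Let $t_1<t_2$ be iterations (the iterations being continued formally, whether or not the stopping test is met) for which bases are recorded. If $\hat{\mathbb U}_d^{t_1}=\hat{\mathbb U}_d^{t_2}$ and $\mathfrak B^{t_1}_{\mathbf u_d}=\mathfrak B^{t_2}_{\mathbf u_d}$ for all $\mathbf u_d\in\hat{\mathbb U}_d^{t_1}$, then the stopping test $UB\le LB$ holds in iteration $t_2$, and $\mathbf x^{t_1}$ is a feasible optimal solution of the two-stage problem. (ii)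 If $\mathcal X\ne\emptyset$, any $T\ge 0$ iterations with feasible master problem in none of which the stopping test holds satisfy $T+1\le|\mathbb U_d|\cdot 2^{\binom{n_u+\mu_u}{\mu_u}}$. That is, the number of iterations of the algorithm, including the one in which it terminates, is at most $|\mathbb U_d|\cdot 2^{\binom{n_u+\mu_u}{\mu_u}}$; no recording of bases is needed here. -/

import Mathlib

open Matrix

noncomputable section

/-- Data of a two-stage robust problem with a mixed integer decision-dependent uncertainty set
and a linear recourse problem,
`min_{x ∈ X} c₁ x + max_{u ∈ U(x)} min_{y ∈ Y(x,u)} c₂ y`.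
Dimensions: `nx`/`mx` continuous/discrete first-stage variables, `mA` first-stage constraints,
`nu`/`mu` continuous/discrete uncertain variables, `muu` constraints of `U(x)`,
`ny` recourse variables and `muy` recourse constraints. -/
structure TwoStageRO (nx mx mA nu mu muu ny muy : ℕ) where
  A : Matrix (Fin mA) (Fin nx ⊕ Fin mx) ℝ
  b : Fin mA → ℝ
  c₁ : Fin nx ⊕ Fin mx → ℝ
  /-- the bounded set of discrete scenarios, a subset of `ℤ₊^mu` -/
  Ud : Finset (Fin mu → ℕ)
  Fc : (Fin nx ⊕ Fin mx → ℝ) → Matrix (Fin muu) (Fin nu) ℝ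
  Fd : (Fin nx ⊕ Fin mx → ℝ) → Matrix (Fin muu) (Fin mu) ℝ
  h : Fin muu → ℝ
  G : Matrix (Fin muu) (Fin nx ⊕ Fin mx) ℝ
  c₂ : Fin ny → ℝ
  B₁ : Matrix (Fin muy) (Fin nx ⊕ Fin mx) ℝ
  B₂ : Matrix (Fin muy) (Fin ny) ℝ
  d : Fin muy → ℝ
  Ec : Matrix (Fin muy) (Fin nu) ℝ
  Ed : Matrix (Fin muy) (Fin mu) ℝ

namespace TwoStageRO

variable {nx mx mA nu mu muu ny muy : ℕ} (P : TwoStageRO nx mx mA nu mu muu ny muy)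

/-- The first-stage feasible set `X ⊆ ℝ₊^nx × ℤ₊^mx`. -/
def X : Set (Fin nx ⊕ Fin mx → ℝ) :=
  {x | 0 ≤ x ∧ (∀ j : Fin mx, ∃ k : ℕ, x (Sum.inr j) = k) ∧ P.b ≤ P.A *ᵥ x}

/-- The real vector of a discrete scenario. -/
def toReal (ud : Fin mu → ℕ) : Fin mu → ℝ := fun j => (ud j : ℝ)

/-- The slack `h + G x - F_d(x) u_d - F_c(x) u_c` of the constraints of the uncertainty set. -/
def slack (x : Fin nx ⊕ Fin mx → ℝ) (ud : Fin mu → ℕ) (uc : Fin nu → ℝ) : Fin muu → ℝ :=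
  P.h + P.G *ᵥ x - P.Fd x *ᵥ toReal ud - P.Fc x *ᵥ uc

/-- The decision-dependent uncertainty set `U(x)`. -/
def U (x : Fin nx ⊕ Fin mx → ℝ) : Set ((Fin nu → ℝ) × (Fin mu → ℕ)) :=
  {u | 0 ≤ u.1 ∧ u.2 ∈ P.Ud ∧ 0 ≤ P.slack x u.2 u.1}

/-- Right-hand side `d - B₁ x - E_c u_c - E_d u_d` of the recourse problem. -/
def rhs (x : Fin nx ⊕ Fin mx → ℝ) (u : (Fin nu → ℝ) × (Fin mu → ℕ)) : Fin muy → ℝ :=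
  P.d - P.B₁ *ᵥ x - P.Ec *ᵥ u.1 - P.Ed *ᵥ toReal u.2

/-- The recourse feasible set `Y(x,u)`. -/
def Y (x : Fin nx ⊕ Fin mx → ℝ) (u : (Fin nu → ℝ) × (Fin mu → ℕ)) : Set (Fin ny → ℝ) :=
  {y | 0 ≤ y ∧ P.rhs x u ≤ P.B₂ *ᵥ y}

/-- Right-hand-side decision dependence: the matrices `F_c`, `F_d` do not depend on `x`. -/
def RHSDependent : Prop :=
  ∀ x x' : Fin nx ⊕ Fin mx → ℝ, P.Fc x = P.Fc x' ∧ P.Fd x = P.Fd x'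

/-- `U(x)` is nonempty for every `x ∈ X`. -/
def NonemptyUncertainty : Prop := ∀ x ∈ P.X, (P.U x).Nonempty

/-- `U(x)` is bounded for every `x ∈ X` (its discrete part is finite anyway). -/
def BoundedUncertainty : Prop := ∀ x ∈ P.X, ∃ K : ℝ, ∀ u ∈ P.U x, ∀ j, u.1 j ≤ K

/-- The monolithic program `min {c₁ x + c₂ y : x ∈ X, u ∈ U(x), y ∈ Y(x,u)}` is bounded below. -/
def MonolithicBounded : Prop :=
  ∃ r : ℝ, ∀ x ∈ P.X, ∀ u ∈ P.U x, ∀ y ∈ P.Y x u, r ≤ P.c₁ ⬝ᵥ x + P.c₂ ⬝ᵥ y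

/-- `min {c₂ y : y ∈ Y(x,u)}`, equal to `+∞` if the recourse problem is infeasible. -/
def recourse (x : Fin nx ⊕ Fin mx → ℝ) (u : (Fin nu → ℝ) × (Fin mu → ℕ)) : EReal :=
  ⨅ y ∈ P.Y x u, ((P.c₂ ⬝ᵥ y : ℝ) : EReal)

/-- The worst case recourse cost of `x`. -/
def worst (x : Fin nx ⊕ Fin mx → ℝ) : EReal := ⨆ u ∈ P.U x, P.recourse x u

/-- The objective of the two-stage robust problem. -/
def objective (x : Fin nx ⊕ Fin mx → ℝ) : EReal := ((P.c₁ ⬝ᵥ x : ℝ) : EReal) + P.worst x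

/-- `x` is a (feasible) optimal first-stage solution of the two-stage robust problem. -/
def IsOptimal (x : Fin nx ⊕ Fin mx → ℝ) : Prop :=
  x ∈ P.X ∧ (∀ u ∈ P.U x, (P.Y x u).Nonempty) ∧ ∀ x' ∈ P.X, P.objective x ≤ P.objective x'

/-! ### Dual of the recourse problem -/

/-- The dual polyhedron `Π = {π ≥ 0 : B₂ᵀ π ≤ c₂}`. -/
def dualPolyhedron : Set (Fin muy → ℝ) := {p | 0 ≤ p ∧ P.B₂ᵀ *ᵥ p ≤ P.c₂}

/-- The set of extreme points of `Π`. -/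
def extremePts : Set (Fin muy → ℝ) := Set.extremePoints ℝ P.dualPolyhedron

/-- The set of extreme rays of `Π`, each represented by its generator with coordinate sum `1`:
these are the extreme points of the base `{γ ≥ 0 : B₂ᵀ γ ≤ 0, 1ᵀ γ = 1}` of the recession cone. -/
def extremeRays : Set (Fin muy → ℝ) :=
  Set.extremePoints ℝ {g | 0 ≤ g ∧ P.B₂ᵀ *ᵥ g ≤ 0 ∧ ∑ i, g i = 1}

/-! ### The parametric linear program `LP(x, u_d, β)`

`max {-(E_c u_c)ᵀ β - M 1ᵀ ũ : F_c(x) u_c - ũ ≤ h + G x - F_d(x) u_d, u_c ≥ 0, ũ ≥ 0}` -/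

/-- The solution set `OU(x, u_d, β)` (for a ray `β`, the set `OV(x, u_d, β)`) of the
Karush-Kuhn-Tucker system of `LP(x, u_d, β)`, in the variables `(u_c, ũ, λ)`. -/
def OU (M : ℝ) (x : Fin nx ⊕ Fin mx → ℝ) (ud : Fin mu → ℕ) (β : Fin muy → ℝ) :
    Set ((Fin nu → ℝ) × (Fin muu → ℝ) × (Fin muu → ℝ)) :=
  {w | 0 ≤ w.1 ∧ 0 ≤ w.2.1 ∧ 0 ≤ P.slack x ud w.1 + w.2.1 ∧
    0 ≤ w.2.2 ∧ (∀ i, w.2.2 i ≤ M) ∧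
    0 ≤ (P.Fc x)ᵀ *ᵥ w.2.2 + P.Ecᵀ *ᵥ β ∧
    (∀ i, w.2.2 i * (P.slack x ud w.1 + w.2.1) i = 0) ∧
    (∀ j, w.1 j * ((P.Fc x)ᵀ *ᵥ w.2.2 + P.Ecᵀ *ᵥ β) j = 0) ∧
    (∀ i, w.2.1 i * (M - w.2.2 i) = 0)}

/-- The constraint matrix `[F_c(x)  I]` of `U(x | u_d)` in equality form
`F_c(x) u_c + s = h + G x - F_d(x) u_d`, `u_c ≥ 0`, `s ≥ 0`. -/
def stdMatrix (x : Fin nx ⊕ Fin mx → ℝ) : Matrix (Fin muu) (Fin nu ⊕ Fin muu) ℝ :=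
  Matrix.fromCols (P.Fc x) 1

/-- `B` is a basis of the equality form: `muu` linearly independent columns of `[F_c(x)  I]`
(the columns of the artificial variables `ũ` are not in the basis). -/
def IsBasis (x : Fin nx ⊕ Fin mx → ℝ) (B : Finset (Fin nu ⊕ Fin muu)) : Prop :=
  B.card = muu ∧ LinearIndependent ℝ (fun j : B => (P.stdMatrix x).col j)

/-- `u_c` (with its slack) is the basic solution of the basis `B`: all nonbasic variables vanish. -/
def IsBasicSolution (x : Fin nx ⊕ Fin mx → ℝ) (ud : Fin mu → ℕ)
    (B : Finset (Fin nu ⊕ Fin muu)) (uc : Fin nu → ℝ) : Prop :=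
  (∀ j, Sum.inl j ∉ B → uc j = 0) ∧ (∀ i, Sum.inr i ∉ B → P.slack x ud uc i = 0)

/-- `B` is dual feasible for `LP(x, u_d, β)`: its multipliers `λ` make the reduced costs of the
basic variables zero and those of all variables (`u_c`, slack, `ũ`) of the right sign. -/
def IsDualFeasibleBasis (M : ℝ) (x : Fin nx ⊕ Fin mx → ℝ) (β : Fin muy → ℝ)
    (B : Finset (Fin nu ⊕ Fin muu)) : Prop :=
  ∃ lam : Fin muu → ℝ,
    (∀ j, Sum.inl j ∈ B → ((P.Fc x)ᵀ *ᵥ lam + P.Ecᵀ *ᵥ β) j = 0) ∧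
    (∀ i, Sum.inr i ∈ B → lam i = 0) ∧
    0 ≤ (P.Fc x)ᵀ *ᵥ lam + P.Ecᵀ *ᵥ β ∧ 0 ≤ lam ∧ ∀ i, lam i ≤ M

/-- `B` is an optimal basis (primal and dual feasible) of `LP(x, u_d, β)`, with basic solution
`(u_c, ũ) = (uc, 0)`. -/
def IsOptimalBasis (M : ℝ) (x : Fin nx ⊕ Fin mx → ℝ) (ud : Fin mu → ℕ) (β : Fin muy → ℝ)
    (B : Finset (Fin nu ⊕ Fin muu)) (uc : Fin nu → ℝ) : Prop :=
  P.IsBasis x B ∧ P.IsBasicSolution x ud B uc ∧ 0 ≤ uc ∧ 0 ≤ P.slack x ud uc ∧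
    P.IsDualFeasibleBasis M x β B

/-! ### Subproblems -/

/-- `min {1ᵀ ỹ : B₂ y + ỹ ≥ d - B₁ x - E u, y ≥ 0, ỹ ≥ 0}`. -/
def violation (x : Fin nx ⊕ Fin mx → ℝ) (u : (Fin nu → ℝ) × (Fin mu → ℕ)) : EReal :=
  ⨅ w ∈ {w : (Fin ny → ℝ) × (Fin muy → ℝ) | 0 ≤ w.1 ∧ 0 ≤ w.2 ∧ P.rhs x u ≤ P.B₂ *ᵥ w.1 + w.2},
    ((∑ i, w.2 i : ℝ) : EReal)

/-- The optimal value `η_f(x)` of the first subproblem. -/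
def etaF (x : Fin nx ⊕ Fin mx → ℝ) : EReal := ⨆ u ∈ P.U x, P.violation x u

/-- `u` is an optimal solution of the first subproblem at `x`. -/
def SolvesSP1 (x : Fin nx ⊕ Fin mx → ℝ) (u : (Fin nu → ℝ) × (Fin mu → ℕ)) : Prop :=
  u ∈ P.U x ∧ P.violation x u = P.etaF x

/-- `(u, π)` is an optimal solution of the second subproblem at `x`: `u` is a worst case scenario
and the extreme point `π` of `Π` is an optimal dual solution of the recourse problem at `u`. -/
def SolvesSP2 (x : Fin nx ⊕ Fin mx → ℝ) (u : (Fin nu → ℝ) × (Fin mu → ℕ))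
    (p : Fin muy → ℝ) : Prop :=
  u ∈ P.U x ∧ P.recourse x u = P.worst x ∧ p ∈ P.extremePts ∧
    ∀ q ∈ P.dualPolyhedron, P.rhs x u ⬝ᵥ q ≤ P.rhs x u ⬝ᵥ p

/-- `γ` is an extreme ray of `Π` along which the third subproblem
`max {(d - B₁ x - E u)ᵀ π : π ∈ Π}` is unbounded. -/
def SolvesSP3 (x : Fin nx ⊕ Fin mx → ℝ) (u : (Fin nu → ℝ) × (Fin mu → ℕ))
    (g : Fin muy → ℝ) : Prop :=
  g ∈ P.extremeRays ∧ 0 < P.rhs x u ⬝ᵥ g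

/-! ### The master problem -/

/-- A cut is indexed by `(u_d, β)` with `β` an extreme point or an extreme ray of `Π`. -/
abbrev Cut (mu muy : ℕ) : Type := (Fin mu → ℕ) × (Fin muy → ℝ)

/-- A point of the master problem; the variables `uc, ut, lam, y` (`ut` is `ũ`) are created for
every cut, and only those of the cuts present in the problem matter.  The value `η = -∞` is
allowed: it occurs when no cut bounds `η` from below. -/
structure MasterPoint (nx mx nu mu muu ny muy : ℕ) where
  x : Fin nx ⊕ Fin mx → ℝ
  eta : EReal
  uc : Cut mu muy → Fin nu → ℝ
  ut : Cut mu muy → Fin muu → ℝ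
  lam : Cut mu muy → Fin muu → ℝ
  y : Cut mu muy → Fin ny → ℝ

/-- Feasibility in the master problem with the set `D` of (unified) cuts.  The indicator of `ũ`,
which is `0` if `ũ = 0` and `+∞` otherwise, switches the inequalities off when `ũ ≠ 0`. -/
def MasterFeasible (M : ℝ) (D : Set (Cut mu muy)) (p : MasterPoint nx mx nu mu muu ny muy) :
    Prop :=
  p.x ∈ P.X ∧ ∀ c ∈ D,
    (p.uc c, p.ut c, p.lam c) ∈ P.OU M p.x c.1 c.2 ∧ 0 ≤ p.y c ∧
    (p.ut c = 0 → ((P.c₂ ⬝ᵥ p.y c : ℝ) : EReal) ≤ p.eta ∧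
      P.rhs p.x (p.uc c, c.1) ≤ P.B₂ *ᵥ p.y c)

/-- Objective of the master problem. -/
def masterObj (p : MasterPoint nx mx nu mu muu ny muy) : EReal :=
  ((P.c₁ ⬝ᵥ p.x : ℝ) : EReal) + p.eta

/-- `p` is an optimal solution of the master problem with the set `D` of cuts. -/
def MasterOptimal (M : ℝ) (D : Set (Cut mu muy)) (p : MasterPoint nx mx nu mu muu ny muy) :
    Prop :=
  P.MasterFeasible M D p ∧ ∀ q, P.MasterFeasible M D q → P.masterObj p ≤ P.masterObj q

/-! ### Parametric C&CG-MIU -/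

/-- What one iteration produces: an optimal solution of the master problem, the cut generated by
the subproblems, and the value `η_o`. -/
structure Iteration (nx mx nu mu muu ny muy : ℕ) where
  sol : MasterPoint nx mx nu mu muu ny muy
  cut : Cut mu muy
  etaO : EReal

/-- Steps 2 to 4 of the algorithm, when the master problem (with cuts `D`) is feasible. -/
def IsIteration (M : ℝ) (D : Set (Cut mu muy)) (it : Iteration nx mx nu mu muu ny muy) : Prop :=
  P.MasterOptimal M D it.sol ∧
  ((P.etaF it.sol.x = 0 ∧
      (∃ uc, P.SolvesSP2 it.sol.x (uc, it.cut.1) it.cut.2) ∧ it.etaO = P.worst it.sol.x) ∨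
   (0 < P.etaF it.sol.x ∧
      (∃ uc, P.SolvesSP1 it.sol.x (uc, it.cut.1) ∧ P.SolvesSP3 it.sol.x (uc, it.cut.1) it.cut.2) ∧
      it.etaO = ⊤))

/-- The cuts in the master problem that is solved in iteration `t`: those generated in the
iterations `1, …, t - 1` (there is no cut initially). -/
def cuts (it : ℕ → Iteration nx mx nu mu muu ny muy) (t : ℕ) : Set (Cut mu muy) :=
  {c | ∃ s, 1 ≤ s ∧ s < t ∧ (it s).cut = c}

/-- `it 1, …, it T` are iterations of parametric C&CG-MIU, in each of which the master problem is
feasible.  The stopping test is a separate predicate `Stops`: the algorithm terminates as soon as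
it holds, or when the master problem is infeasible; the iterations may be continued formally. -/
def IsRun (M : ℝ) (T : ℕ) (it : ℕ → Iteration nx mx nu mu muu ny muy) : Prop :=
  ∀ t, 1 ≤ t → t ≤ T → P.IsIteration M (cuts it t) (it t)

/-- The lower bound after iteration `t`. -/
def LB (it : ℕ → Iteration nx mx nu mu muu ny muy) (t : ℕ) : EReal := P.masterObj (it t).sol

/-- The upper bound after iteration `t`. -/
def UB (it : ℕ → Iteration nx mx nu mu muu ny muy) : ℕ → EReal
  | 0 => ⊤
  | t + 1 => min (UB it t) (((P.c₁ ⬝ᵥ (it (t + 1)).sol.x : ℝ) : EReal) + (it (t + 1)).etaO)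

/-- The stopping test `UB - LB ≤ 0` in iteration `t` (the tolerance is zero). -/
def Stops (it : ℕ → Iteration nx mx nu mu muu ny muy) (t : ℕ) : Prop := P.UB it t ≤ P.LB it t

/-! ### Scenarios and bases in the master problem -/

/-- The discrete scenarios that appear in the master problem of iteration `t`. -/
def scenarios (it : ℕ → Iteration nx mx nu mu muu ny muy) (t : ℕ) : Set (Fin mu → ℕ) :=
  {ud | ∃ β, (ud, β) ∈ cuts it t}

/-- `rec c` is, for every cut `c` with `ũ = 0` in the optimal master solution of iteration `t`, a
nonempty family (for example a single one) of optimal bases of `LP(xᵗ, u_d, β)` whose basic solution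
is the point of `OU(xᵗ, u_d, β)` in that master solution. -/
def IsBasisRecord (M : ℝ) (it : ℕ → Iteration nx mx nu mu muu ny muy) (t : ℕ)
    (rec : Cut mu muy → Set (Finset (Fin nu ⊕ Fin muu))) : Prop :=
  ∀ c ∈ cuts it t, (it t).sol.ut c = 0 →
    (rec c).Nonempty ∧
      ∀ B ∈ rec c, P.IsOptimalBasis M (it t).sol.x c.1 c.2 B ((it t).sol.uc c)

/-- The collection of bases obtained in iteration `t` for the discrete scenario `ud`. -/
def basisCollection (it : ℕ → Iteration nx mx nu mu muu ny muy) (t : ℕ)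
    (rec : Cut mu muy → Set (Finset (Fin nu ⊕ Fin muu))) (ud : Fin mu → ℕ) :
    Set (Finset (Fin nu ⊕ Fin muu)) :=
  {B | ∃ β, (ud, β) ∈ cuts it t ∧ (it t).sol.ut (ud, β) = 0 ∧ B ∈ rec (ud, β)}

end TwoStageRO

end

/-! Both parts rest on one observation, `worst_le_of_optimal_for_cut`. Suppose iteration `t`
generates `(u_d, β*)` while the master already holds a cut with the same `u_d`, with `ũ = 0`, whose
point `u_c` minimizes `(E_cᵀ β*) · u` over the completions of `u_d`. Then `u_c` has a dual value at
`β*` at least that of the generated scenario. Weak duality for the `y` of that cut rules out a ray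
`β*`, and for an extreme point it gives `worst ≤ η`. The objective at `xᵗ` is thus at most the lower
bound.

For (i), a basis recorded at `t₂` for the pair generated at `t₁` is dual feasible for `β*`, a
property free of `x` since `F_c` is constant. By equality of the collections it is also recorded at
`t₁`, where it supplies the basic solution. Complementary slackness makes that solution optimal for
`β*`, so the gap already closes at `x` of iteration `t₁`.

For (ii), label an iteration by `u_d` and the family of dual feasible index sets of `E_cᵀ β`. By
`optimal_of_dualFeasibleSets_subset` a repeated label yields the observation, hence a stop. The
families are nonempty, so there are at most `|U_d| (2^C - 1)` labels, with `C` the binomial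
coefficient.

A large `M` forces `ũ = 0` whenever `u_d` can be completed (`exists_exact_penalty`), uniformly in
`x`, which enters only the right-hand side. -/

namespace LinearProgram

variable {ι m n N : Type*} [Fintype m] [Fintype n] [Fintype N]

/-! ### Farkas' lemma and linear programming duality. -/

/-- **Farkas' lemma** for finitely many linear functionals. -/
theorem farkas_functionals {V : Type*} [AddCommGroup V] [Module ℝ V] (s : Finset ι) :
    ∀ (a : ι → V →ₗ[ℝ] ℝ) (b : V →ₗ[ℝ] ℝ), (∀ v, (∀ i ∈ s, 0 ≤ a i v) → 0 ≤ b v) →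
      ∃ c : ι → ℝ, (∀ i, 0 ≤ c i) ∧ ∀ v, b v = ∑ i ∈ s, c i * a i v := by
  classical
  induction s using Finset.induction_on with
  | empty =>
    intro a b h
    refine ⟨0, fun _ => le_rfl, fun v => ?_⟩
    have h1 := h v (by simp)
    have h2 := h (-v) (by simp)
    rw [map_neg] at h2
    simp only [Finset.sum_empty]
    linarith
  | insert k s hk ih =>
    intro a b h
    by_cases hs : ∀ v, (∀ i ∈ s, 0 ≤ a i v) → 0 ≤ b v
    · obtain ⟨c, hc, hb⟩ := ih a b hs
      refine ⟨Function.update c k 0, fun i => ?_, fun v => ?_⟩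
      · by_cases hi : i = k
        · subst hi; simp
        · simp [hi, hc i]
      · rw [Finset.sum_insert hk, hb v]
        simp only [Function.update_self, zero_mul, zero_add]
        refine Finset.sum_congr rfl fun i hi => ?_
        rw [Function.update_of_ne (ne_of_mem_of_not_mem hi hk)]
    · push Not at hs
      obtain ⟨w, hw, hbw⟩ := hs
      have hkw : a k w < 0 := by
        by_contra hcon
        refine absurd (h w fun i hi => ?_) (not_le.mpr hbw)
        rcases Finset.mem_insert.mp hi with rfl | hi
        · exact not_lt.mp hcon
        · exact hw i hi
      obtain ⟨v₀, hv₀, hbv₀, hkv₀⟩ :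
          ∃ v₀, (∀ i ∈ s, 0 ≤ a i v₀) ∧ b v₀ < 0 ∧ a k v₀ = -1 := by
        have hp : 0 < (-(a k w))⁻¹ := by
          rw [inv_pos]; linarith
        refine ⟨(-(a k w))⁻¹ • w, fun i hi => ?_, ?_, ?_⟩
        · rw [map_smul, smul_eq_mul]
          exact mul_nonneg hp.le (hw i hi)
        · rw [map_smul, smul_eq_mul]
          exact mul_neg_of_pos_of_neg hp hbw
        · rw [map_smul, smul_eq_mul, inv_neg, neg_mul, inv_mul_cancel₀ hkw.ne]
      -- The map `v ↦ v + a k v • v₀` projects onto the kernel of `a k`, because `a k v₀ = -1`. The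
      -- induction hypothesis is applied to the functionals composed with this projection.
      obtain ⟨c, hc, hb⟩ := ih (fun i => a i + a i v₀ • a k) (b + b v₀ • a k) (by
        intro v hv
        have := h (v + a k v • v₀) (by
          intro i hi
          rcases Finset.mem_insert.mp hi with rfl | hi
          · simp [hkv₀]
          · have := hv i hi
            simp only [LinearMap.add_apply, LinearMap.smul_apply, smul_eq_mul, map_add,
              map_smul] at this ⊢
            linarith)
        simp only [LinearMap.add_apply, LinearMap.smul_apply, smul_eq_mul, map_add,
          map_smul] at this ⊢
        linarith)
      refine ⟨Function.update c k (∑ i ∈ s, c i * a i v₀ - b v₀), fun i => ?_, fun v => ?_⟩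
      · by_cases hi : i = k
        · subst hi
          have : 0 ≤ ∑ i ∈ s, c i * a i v₀ :=
            Finset.sum_nonneg fun i hi => mul_nonneg (hc i) (hv₀ i hi)
          simp only [Function.update_self]
          linarith
        · simp [hi, hc i]
      · rw [Finset.sum_insert hk]
        have h1 := hb v
        simp only [LinearMap.add_apply, LinearMap.smul_apply, smul_eq_mul, mul_add,
          Finset.sum_add_distrib] at h1
        have h2 : ∑ i ∈ s, Function.update c k (∑ i ∈ s, c i * a i v₀ - b v₀) i * a i v
            = ∑ i ∈ s, c i * a i v := by
          refine Finset.sum_congr rfl fun i hi => ?_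
          rw [Function.update_of_ne (ne_of_mem_of_not_mem hi hk)]
        have h3 : ∑ i ∈ s, c i * (a i v₀ * a k v) = (∑ i ∈ s, c i * a i v₀) * a k v := by
          rw [Finset.sum_mul]
          exact Finset.sum_congr rfl fun i _ => by ring
        rw [h2, Function.update_self]
        rw [h3] at h1
        linarith

/-- **Farkas' lemma** for `A x ≥ b`, `x ≥ 0`. -/
theorem farkas (A : Matrix m n ℝ) (b : m → ℝ)
    (h : ∀ p : m → ℝ, 0 ≤ p → Aᵀ *ᵥ p ≤ 0 → b ⬝ᵥ p ≤ 0) :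
    ∃ x : n → ℝ, 0 ≤ x ∧ b ≤ A *ᵥ x := by
  classical
  let a : m ⊕ n → (m → ℝ) →ₗ[ℝ] ℝ :=
    Sum.elim (fun i => LinearMap.proj i) (fun j => -(LinearMap.proj j ∘ₗ Aᵀ.mulVecLin))
  let f : (m → ℝ) →ₗ[ℝ] ℝ := -(dotProductBilin ℝ ℝ b)
  obtain ⟨c, hc, hf⟩ := farkas_functionals Finset.univ a f (by
    intro p hp
    have h1 : 0 ≤ p := fun i => hp (Sum.inl i) (Finset.mem_univ _)
    have h2 : Aᵀ *ᵥ p ≤ 0 := fun j => by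
      have := hp (Sum.inr j) (Finset.mem_univ _)
      simp only [a, Sum.elim_inr, LinearMap.neg_apply, LinearMap.comp_apply, mulVecLin_apply,
        LinearMap.proj_apply, Left.nonneg_neg_iff] at this
      exact this
    have := h p h1 h2
    simpa [f] using this)
  refine ⟨fun j => c (Sum.inr j), fun j => hc _, fun i => ?_⟩
  have := hf (Pi.single i 1)
  simp [f, a, Fintype.sum_sum_type, Pi.single_apply] at this
  have h1 := hc (Sum.inl i)
  have h2 : (A *ᵥ fun j => c (Sum.inr j)) i = ∑ j, c (Sum.inr j) * A i j := by
    simp only [mulVec, dotProduct]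
    exact Finset.sum_congr rfl fun j _ => mul_comm _ _
  rw [h2]
  linarith

theorem weak_duality (A : Matrix m n ℝ) {b : m → ℝ} {c x : n → ℝ} {p : m → ℝ}
    (hx : 0 ≤ x) (hAx : b ≤ A *ᵥ x) (hp : 0 ≤ p) (hAp : Aᵀ *ᵥ p ≤ c) : b ⬝ᵥ p ≤ c ⬝ᵥ x := by
  calc b ⬝ᵥ p ≤ (A *ᵥ x) ⬝ᵥ p := dotProduct_le_dotProduct_of_nonneg_right hAx hp
    _ = (Aᵀ *ᵥ p) ⬝ᵥ x := by
      rw [dotProduct_comm, dotProduct_mulVec, mulVec_transpose]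
    _ ≤ c ⬝ᵥ x := dotProduct_le_dotProduct_of_nonneg_right hAp hx

/-- Strong duality: a feasible linear program with a feasible dual has optimal solutions without
duality gap. -/
theorem strong_duality (A : Matrix m n ℝ) {b : m → ℝ} {c x₀ : n → ℝ} {p₀ : m → ℝ}
    (hx : 0 ≤ x₀) (hAx : b ≤ A *ᵥ x₀) (hp : 0 ≤ p₀) (hAp : Aᵀ *ᵥ p₀ ≤ c) :
    ∃ x p, 0 ≤ x ∧ b ≤ A *ᵥ x ∧ 0 ≤ p ∧ Aᵀ *ᵥ p ≤ c ∧ c ⬝ᵥ x = b ⬝ᵥ p := by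
  -- Farkas is applied to primal feasibility, dual feasibility and `b · p ≥ c · x` as a single
  -- system in `(x, p)`.
  obtain ⟨w, hw, hKw⟩ := farkas
    (fromRows (fromBlocks A 0 0 (-Aᵀ)) (replicateRow Unit (Sum.elim (-c) b)))
    (Sum.elim (Sum.elim b (-c)) 0) (by
      intro q hq hKq
      obtain ⟨u, v, τ, rfl⟩ : ∃ u v τ, q = Sum.elim (Sum.elim u v) (fun _ => τ) :=
        ⟨fun i => q (Sum.inl (Sum.inl i)), fun j => q (Sum.inl (Sum.inr j)), q (Sum.inr ()), by
          ext ((i | j) | k) <;> rfl⟩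
      have hu : 0 ≤ u := fun i => hq (Sum.inl (Sum.inl i))
      have hv : 0 ≤ v := fun i => hq (Sum.inl (Sum.inr i))
      have hτ : 0 ≤ τ := hq (Sum.inr ())
      have h1 : Aᵀ *ᵥ u ≤ τ • c := fun j => by
        have := hKq (Sum.inl j)
        simp [replicateRow, mulVec, dotProduct] at this
        simp [mulVec, dotProduct]
        linarith
      have h2 : τ • b ≤ A *ᵥ v := fun j => by
        have := hKq (Sum.inr j)
        simp [replicateRow, mulVec, dotProduct] at this
        simp [mulVec, dotProduct]
        linarith
      have goal : b ⬝ᵥ u ≤ c ⬝ᵥ v := by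
        -- For `τ = 0` the vectors `u`, `v` are recession directions, tested against `x₀` and `p₀`;
        -- for `τ > 0` weak duality applies to the data scaled by `τ`.
        rcases hτ.eq_or_lt with h0 | h0
        · subst h0
          rw [zero_smul] at h1 h2
          have e1 := weak_duality A hx hAx hu h1
          have e2 := weak_duality A hv h2 hp hAp
          rw [zero_dotProduct] at e1 e2
          linarith
        · have := weak_duality A hv h2 hu h1
          rw [smul_dotProduct, smul_dotProduct] at this
          exact le_of_mul_le_mul_left this h0
      simpa [sumElim_dotProduct_sumElim] using goal)
  obtain ⟨x, p, rfl⟩ : ∃ x p, w = Sum.elim x p :=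
    ⟨fun i => w (Sum.inl i), fun j => w (Sum.inr j), by ext (i | j) <;> rfl⟩
  have h1 : 0 ≤ x := fun i => hw (Sum.inl i)
  have h2 : 0 ≤ p := fun i => hw (Sum.inr i)
  have h3 : b ≤ A *ᵥ x := fun i => by
    simpa [fromRows_mulVec, fromBlocks_mulVec] using hKw (Sum.inl (Sum.inl i))
  have h4 : Aᵀ *ᵥ p ≤ c := fun i => by
    simpa [fromRows_mulVec, fromBlocks_mulVec, neg_mulVec] using hKw (Sum.inl (Sum.inr i))
  have h5 : c ⬝ᵥ x ≤ b ⬝ᵥ p := by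
    have := hKw (Sum.inr ())
    simp [replicateRow, mulVec] at this
    simpa [dotProduct] using this
  exact ⟨x, p, h1, h3, h2, h4, le_antisymm h5 (weak_duality A h1 h3 h2 h4)⟩

/-- The Lagrangian identity: it compares costs of points through reduced costs for a common
multiplier. -/
theorem dotProduct_eq_sub (F : Matrix m n ℝ) (q u : n → ℝ) (p : m → ℝ) :
    q ⬝ᵥ u = u ⬝ᵥ (Fᵀ *ᵥ p + q) - p ⬝ᵥ (F *ᵥ u) := by
  rw [dotProduct_add, dotProduct_comm u q, dotProduct_mulVec, ← mulVec_transpose,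
    transpose_transpose, dotProduct_comm (F *ᵥ u)]
  ring

theorem dotProduct_eq_zero_of_forall {v w : n → ℝ} (h : ∀ i, v i * w i = 0) : v ⬝ᵥ w = 0 :=
  Finset.sum_eq_zero fun i _ => h i

theorem forall_mul_eq_zero_of_dotProduct_le {v w : n → ℝ} (hv : 0 ≤ v) (hw : 0 ≤ w)
    (h : v ⬝ᵥ w ≤ 0) (i : n) : v i * w i = 0 := by
  have h0 : ∀ i ∈ Finset.univ, 0 ≤ v i * w i := fun i _ => mul_nonneg (hv i) (hw i)
  exact (Finset.sum_eq_zero_iff_of_nonneg h0).mp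
    (le_antisymm h (Finset.sum_nonneg h0)) i (Finset.mem_univ i)

/-- Complementary slackness implies optimality for `min {q u : F u ≤ r, u ≥ 0}`. -/
theorem optimal_of_complementary (F : Matrix m n ℝ) {q u u' : n → ℝ} {r p : m → ℝ}
    (hp : 0 ≤ p) (hd : 0 ≤ Fᵀ *ᵥ p + q) (hs : ∀ i, p i * (r - F *ᵥ u) i = 0)
    (hz : ∀ j, u j * (Fᵀ *ᵥ p + q) j = 0) (hu' : 0 ≤ u') (hr : 0 ≤ r - F *ᵥ u') :
    q ⬝ᵥ u ≤ q ⬝ᵥ u' := by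
  have h1 := dotProduct_eq_zero_of_forall hs
  have h2 := dotProduct_eq_zero_of_forall hz
  have h3 : 0 ≤ p ⬝ᵥ (r - F *ᵥ u') := dotProduct_nonneg_of_nonneg hp hr
  have h4 : 0 ≤ u' ⬝ᵥ (Fᵀ *ᵥ p + q) := dotProduct_nonneg_of_nonneg hu' hd
  rw [dotProduct_eq_sub F q u p, dotProduct_eq_sub F q u' p]
  rw [dotProduct_sub] at h1 h3
  linarith

/-! ### Exact penalization. -/

/-- The penalized program `min {q u + M 1 v : F u - v ≤ r, u, v ≥ 0}` has a Karush-Kuhn-Tucker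
point when its dual is feasible. -/
theorem exists_penalty_kkt (F : Matrix m n ℝ) (q : n → ℝ) (r : m → ℝ) {M : ℝ} {p₀ : m → ℝ}
    (hp : 0 ≤ p₀) (hM : ∀ i, p₀ i ≤ M) (hd : 0 ≤ Fᵀ *ᵥ p₀ + q) :
    ∃ u v p, 0 ≤ u ∧ 0 ≤ v ∧ 0 ≤ r - F *ᵥ u + v ∧ 0 ≤ p ∧ (∀ i, p i ≤ M) ∧ 0 ≤ Fᵀ *ᵥ p + q ∧
      (∀ i, p i * (r - F *ᵥ u + v) i = 0) ∧ (∀ j, u j * (Fᵀ *ᵥ p + q) j = 0) ∧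
      ∀ i, v i * (M - p i) = 0 := by
  classical
  obtain ⟨w, p, hw, hAw, hp', hAp, heq⟩ := strong_duality (fromCols (-F) (1 : Matrix m m ℝ))
    (b := -r) (c := Sum.elim q (fun _ => M)) (x₀ := Sum.elim 0 |r|) (p₀ := p₀)
    (by rintro (i | i) <;> simp) (by
      rw [fromCols_mulVec_sumElim, mulVec_zero, one_mulVec, zero_add]
      exact neg_le_abs r) hp (by
      rw [transpose_fromCols, fromRows_mulVec]
      rintro (i | i)
      · have := hd i
        simp only [Pi.zero_apply, Pi.add_apply] at this
        simp only [Sum.elim_inl, transpose_neg, neg_mulVec, Pi.neg_apply]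
        linarith
      · simpa using hM i)
  obtain ⟨u, v, rfl⟩ : ∃ u v, w = Sum.elim u v :=
    ⟨fun i => w (Sum.inl i), fun j => w (Sum.inr j), by ext (i | j) <;> rfl⟩
  have hu : 0 ≤ u := fun i => hw (Sum.inl i)
  have hv : 0 ≤ v := fun i => hw (Sum.inr i)
  rw [fromCols_mulVec_sumElim, one_mulVec, neg_mulVec] at hAw
  rw [transpose_fromCols, fromRows_mulVec] at hAp
  rw [sumElim_dotProduct_sumElim] at heq
  have hs : 0 ≤ r - F *ᵥ u + v := fun i => by
    have := hAw i
    simp only [Pi.add_apply, Pi.neg_apply, Pi.zero_apply, Pi.sub_apply] at this ⊢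
    linarith
  have hz : 0 ≤ Fᵀ *ᵥ p + q := fun i => by
    have := hAp (Sum.inl i)
    simp only [Sum.elim_inl, transpose_neg, neg_mulVec, Pi.neg_apply] at this
    simp only [Pi.zero_apply, Pi.add_apply]
    linarith
  have hM' : ∀ i, p i ≤ M := fun i => by simpa using hAp (Sum.inr i)
  have hM0 : (0 : m → ℝ) ≤ (fun _ => M) - p := fun i => by
    simpa using hM' i
  have e1 := dotProduct_nonneg_of_nonneg hp' hs
  have e2 := dotProduct_nonneg_of_nonneg hu hz
  have e3 := dotProduct_nonneg_of_nonneg hv hM0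
  -- The three complementarity products add up to the duality gap; being nonnegative, each one
  -- vanishes.
  have e4 : p ⬝ᵥ (r - F *ᵥ u + v) + u ⬝ᵥ (Fᵀ *ᵥ p + q) + v ⬝ᵥ ((fun _ => M) - p) = 0 := by
    rw [dotProduct_eq_sub F q u p, neg_dotProduct, dotProduct_comm r p,
      dotProduct_comm (fun _ => M) v] at heq
    rw [dotProduct_add, dotProduct_sub, dotProduct_sub v, dotProduct_comm v p]
    linarith
  exact ⟨u, v, p, hu, hv, hs, hp', hM', hz,
    forall_mul_eq_zero_of_dotProduct_le hp' hs (by linarith),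
    forall_mul_eq_zero_of_dotProduct_le hu hz (by linarith),
    forall_mul_eq_zero_of_dotProduct_le (w := (fun _ => M) - p) hv hM0 (by linarith)⟩

/-- Exact penalization, uniformly in the right-hand side `r` and over finitely many costs `q`: for
large `M` every Karush-Kuhn-Tucker point of the penalized program has `v = 0` as soon as
`{u ≥ 0 : F u ≤ r}` is nonempty, and the dual of the penalized program is feasible. -/
theorem exists_exact_penalty (F : Matrix m n ℝ) {Q : Set (n → ℝ)} (hQ : Q.Finite)
    (hdual : ∀ q ∈ Q, ∃ p : m → ℝ, 0 ≤ p ∧ 0 ≤ Fᵀ *ᵥ p + q) :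
    ∃ M₀ : ℝ, ∀ M, M₀ ≤ M → ∀ q ∈ Q,
      (∃ p : m → ℝ, 0 ≤ p ∧ (∀ i, p i ≤ M) ∧ 0 ≤ Fᵀ *ᵥ p + q) ∧
      ∀ (r : m → ℝ) (u₀ u : n → ℝ) (v p : m → ℝ), 0 ≤ u₀ → 0 ≤ r - F *ᵥ u₀ →
        0 ≤ u → 0 ≤ v → 0 ≤ r - F *ᵥ u + v → 0 ≤ p → 0 ≤ Fᵀ *ᵥ p + q →
        (∀ i, p i * (r - F *ᵥ u + v) i = 0) → (∀ j, u j * (Fᵀ *ᵥ p + q) j = 0) →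
        (∀ i, v i * (M - p i) = 0) → v = 0 := by
  classical
  -- Complementarity sees a dual solution only through its vanishing pattern. There are finitely
  -- many patterns and costs, so one representative per nonempty face suffices, and a bound on these
  -- holds for every `r`.
  let face : Q × Set m × Set n → Set (m → ℝ) := fun k =>
    {p | 0 ≤ p ∧ 0 ≤ Fᵀ *ᵥ p + k.1.1 ∧ (∀ i ∈ k.2.1, p i = 0) ∧
      ∀ j ∈ k.2.2, (Fᵀ *ᵥ p + k.1.1) j = 0}
  have : Finite Q := hQ
  have hrep : ∀ k, ∃ p, (face k).Nonempty → p ∈ face k := fun k => by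
    by_cases h : (face k).Nonempty
    · exact ⟨h.some, fun _ => h.some_mem⟩
    · exact ⟨0, fun h' => absurd h' h⟩
  choose rep hrep using hrep
  obtain ⟨K, hK⟩ := (Set.finite_range fun k : (Q × Set m × Set n) × m => rep k.1 k.2).bddAbove
  -- The `+ 1` puts `M` strictly above every coordinate of every representative.
  refine ⟨K + 1, fun M hM q hq => ⟨?_, ?_⟩⟩
  · obtain ⟨p, hp, hd⟩ := hdual q hq
    have := hrep (⟨q, hq⟩, ∅, ∅) ⟨p, hp, hd, by simp, by simp⟩
    refine ⟨_, this.1, fun i => ?_, this.2.1⟩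
    have := hK ⟨((⟨q, hq⟩, ∅, ∅), i), rfl⟩
    simp only at this
    linarith
  · intro r u₀ u v p hu₀ hr₀ hu hv hr hp hd hs hz hvp
    obtain ⟨p₀, hp₀, hd₀⟩ := hdual q hq
    obtain ⟨u₁, p₁, hu₁, hr₁, hp₁, hd₁, heq⟩ := strong_duality (-F) (b := -r) (c := q)
      (x₀ := u₀) (p₀ := p₀) hu₀ (by
        rw [neg_mulVec]
        exact neg_le_neg (sub_nonneg.mp hr₀)) hp₀ (by
        rw [transpose_neg, neg_mulVec]
        exact neg_le_iff_add_nonneg'.mpr hd₀)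
    rw [neg_mulVec, neg_le_neg_iff, ← sub_nonneg] at hr₁
    rw [transpose_neg, neg_mulVec, neg_le_iff_add_nonneg'] at hd₁
    have e1 := dotProduct_nonneg_of_nonneg hp₁ hr₁
    have e2 := dotProduct_nonneg_of_nonneg hu₁ hd₁
    have e3 : p₁ ⬝ᵥ (r - F *ᵥ u₁) + u₁ ⬝ᵥ (Fᵀ *ᵥ p₁ + q) = 0 := by
      rw [dotProduct_eq_sub F q u₁ p₁, neg_dotProduct, dotProduct_comm r] at heq
      rw [dotProduct_sub]
      linarith
    have hs₁ := forall_mul_eq_zero_of_dotProduct_le hp₁ hr₁ (by linarith)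
    have hz₁ := forall_mul_eq_zero_of_dotProduct_le hu₁ hd₁ (by linarith)
    let k : Q × Set m × Set n := (⟨q, hq⟩, {i | (r - F *ᵥ u₁) i ≠ 0}, {j | u₁ j ≠ 0})
    obtain ⟨hp₂, hd₂, hs₂, hz₂⟩ := hrep k ⟨p₁, hp₁, hd₁,
      fun i hi => (mul_eq_zero.mp (hs₁ i)).resolve_right hi,
      fun j hj => (mul_eq_zero.mp (hz₁ j)).resolve_left hj⟩
    have hK₂ : ∀ i, rep k i < M := fun i => by
      have := hK ⟨(k, i), rfl⟩
      simp only at this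
      linarith
    generalize rep k = p₂ at hp₂ hd₂ hs₂ hz₂ hK₂
    simp only [k] at hd₂ hs₂ hz₂
    have f1 : p₂ ⬝ᵥ (r - F *ᵥ u₁) = 0 := dotProduct_eq_zero_of_forall fun i => by
      by_cases h : (r - F *ᵥ u₁) i = 0
      · rw [h, mul_zero]
      · rw [hs₂ i h, zero_mul]
    have f2 : u₁ ⬝ᵥ (Fᵀ *ᵥ p₂ + q) = 0 := dotProduct_eq_zero_of_forall fun i => by
      by_cases h : u₁ i = 0
      · rw [h, zero_mul]
      · rw [hz₂ i h, mul_zero]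
    have f3 := dotProduct_eq_zero_of_forall hs
    have f4 := dotProduct_eq_zero_of_forall hz
    have f5 : v ⬝ᵥ ((fun _ => M) - p) = 0 := dotProduct_eq_zero_of_forall hvp
    have f6 := dotProduct_nonneg_of_nonneg hp₂ hr
    have f7 := dotProduct_nonneg_of_nonneg hu hd₂
    have f8 := dotProduct_nonneg_of_nonneg hp hr₁
    have f9 := dotProduct_nonneg_of_nonneg hu₁ hd
    have g1 := dotProduct_eq_sub F q u₁ p₂
    have g2 := dotProduct_eq_sub F q u p
    have g3 := dotProduct_eq_sub F q u₁ p
    have g4 := dotProduct_eq_sub F q u p₂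
    have hM₂ : (0 : m → ℝ) ≤ (fun _ => M) - p₂ := fun i => by
      simpa using (hK₂ i).le
    -- Optimality of the penalized point gives `q · u + M 1 · v ≤ q · u₁`, while the multiplier `p₂`
    -- gives `q · u₁ ≤ q · u + p₂ · v`. Hence `(M - p₂) · v ≤ 0`.
    have key := forall_mul_eq_zero_of_dotProduct_le hv hM₂ (by
      simp only [dotProduct_add, dotProduct_sub] at *
      rw [dotProduct_comm v p] at f5
      rw [dotProduct_comm v p₂]
      linarith)
    ext i
    have := sub_pos.mpr (hK₂ i)
    exact (mul_eq_zero.mp (key i)).resolve_right this.ne'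

/-! ### Vertices, small supports and dual feasible index sets. -/

/-- The ratio test. -/
theorem exists_ratio_step {z δ : N → ℝ} (hz : 0 ≤ z) (hδ : ∃ j, δ j < 0) :
    ∃ t : ℝ, 0 ≤ t ∧ 0 ≤ z + t • δ ∧ ∃ j, δ j < 0 ∧ (z + t • δ) j = 0 := by
  classical
  obtain ⟨j₀, hj₀⟩ := hδ
  obtain ⟨j, hj, hmin⟩ := Finset.exists_min_image (Finset.univ.filter fun j => δ j < 0)
    (fun j => z j / -δ j) ⟨j₀, by simpa using hj₀⟩
  have hj' : δ j < 0 := by simpa using hj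
  have ht : 0 ≤ z j / -δ j := div_nonneg (hz j) (by linarith)
  refine ⟨z j / -δ j, ht, fun i => ?_, j, hj', ?_⟩
  · simp only [Pi.zero_apply, Pi.add_apply, Pi.smul_apply, smul_eq_mul]
    have hzi : 0 ≤ z i := hz i
    rcases lt_or_ge (δ i) 0 with hi | hi
    · have h1 := hmin i (by simpa using hi)
      rw [le_div_iff₀ (by linarith)] at h1
      linarith
    · have := mul_nonneg ht hi
      linarith
  · simp only [Pi.add_apply, Pi.smul_apply, smul_eq_mul]
    have := hj'.ne
    field_simp
    ring

/-- A point of the pointed polyhedron `{p : Aᵀ p + c ≥ 0}` can be moved within its face to a point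
with at least as many tight constraints as there are variables. -/
theorem exists_vertex (A : Matrix m N ℝ) (c : N → ℝ) (hA : ∀ μ : m → ℝ, Aᵀ *ᵥ μ = 0 → μ = 0)
    (p : m → ℝ) (hp : 0 ≤ Aᵀ *ᵥ p + c) :
    ∃ p', 0 ≤ Aᵀ *ᵥ p' + c ∧ (∀ j, (Aᵀ *ᵥ p + c) j = 0 → (Aᵀ *ᵥ p' + c) j = 0) ∧
      ∃ Z : Finset N, Fintype.card m ≤ Z.card ∧ (∀ j, j ∈ Z ↔ (Aᵀ *ᵥ p' + c) j = 0) := by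
  classical
  induction hk : (Finset.univ.filter fun j => (Aᵀ *ᵥ p + c) j ≠ 0).card
    using Nat.strong_induction_on generalizing p with
  | _ k ih =>
  set Z := Finset.univ.filter fun j => (Aᵀ *ᵥ p + c) j = 0 with hZ
  by_cases hcard : Fintype.card m ≤ Z.card
  · exact ⟨p, hp, fun _ h => h, Z, hcard, fun j => by simp [hZ]⟩
  -- With fewer tight constraints than variables some nonzero direction keeps them all tight; the
  -- ratio test along it makes one more tight.
  · have hker : LinearMap.ker ((LinearMap.funLeft ℝ ℝ (fun j : Z => j.1)) ∘ₗ Aᵀ.mulVecLin) ≠ ⊥ :=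
      LinearMap.ker_ne_bot_of_finrank_lt (by simpa using hcard)
    obtain ⟨μ, hμ, hμ0⟩ := Submodule.exists_mem_ne_zero_of_ne_bot hker
    have hμZ : ∀ j ∈ Z, (Aᵀ *ᵥ μ) j = 0 := fun j hj =>
      congrFun (LinearMap.mem_ker.mp hμ) ⟨j, hj⟩
    obtain ⟨ν, hνZ, hν⟩ : ∃ ν : m → ℝ, (∀ j ∈ Z, (Aᵀ *ᵥ ν) j = 0) ∧ ∃ j, (Aᵀ *ᵥ ν) j < 0 := by
      obtain ⟨j, hj⟩ := Function.ne_iff.mp (fun h => hμ0 (hA μ h))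
      rcases lt_or_gt_of_ne hj with h | h
      · exact ⟨μ, hμZ, j, h⟩
      · refine ⟨-μ, fun i hi => ?_, j, ?_⟩
        · rw [mulVec_neg, Pi.neg_apply, hμZ i hi, neg_zero]
        · rw [mulVec_neg, Pi.neg_apply]
          exact neg_neg_of_pos h
    obtain ⟨t, -, hnonneg, j, hj, hj0⟩ := exists_ratio_step hp hν
    have heq : Aᵀ *ᵥ p + c + t • (Aᵀ *ᵥ ν) = Aᵀ *ᵥ (p + t • ν) + c := by
      rw [mulVec_add, mulVec_smul]
      abel
    have hzero : ∀ i, (Aᵀ *ᵥ p + c) i = 0 → (Aᵀ *ᵥ (p + t • ν) + c) i = 0 := fun i hi => by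
      rw [← heq, Pi.add_apply, hi, Pi.smul_apply, hνZ i (by simpa [hZ] using hi), smul_zero,
        add_zero]
    rw [heq] at hnonneg hj0
    obtain ⟨p', h1, h2, h3⟩ := ih _ (by
      rw [← hk]
      refine Finset.card_lt_card (Finset.ssubset_iff_of_subset (fun i hi => ?_) |>.mpr ⟨j, ?_, ?_⟩)
      · simp only [Finset.mem_filter, Finset.mem_univ, true_and] at hi ⊢
        exact fun h => hi (hzero i h)
      · simp only [Finset.mem_filter, Finset.mem_univ, true_and]
        exact fun h => hj.ne (hνZ j (by simpa [hZ] using h))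
      · simpa using hj0) (p + t • ν) hnonneg rfl
    exact ⟨p', h1, fun i hi => h2 i (hzero i hi), h3⟩

/-- Support reduction in a bounded polyhedron `{w ≥ 0 : A w = r}` without loss in the objective. -/
theorem exists_small_support (A : Matrix m N ℝ) (c : N → ℝ)
    (hA : ∀ d : N → ℝ, 0 ≤ d → A *ᵥ d = 0 → d = 0) (w : N → ℝ) (hw : 0 ≤ w) :
    ∃ w', 0 ≤ w' ∧ A *ᵥ w' = A *ᵥ w ∧ c ⬝ᵥ w' ≤ c ⬝ᵥ w ∧ ∃ S : Finset N,
      S.card ≤ Fintype.card m ∧ (∀ j, w' j ≠ 0 → j ∈ S) ∧ ∀ j ∈ S, w j ≠ 0 := by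
  classical
  induction hk : (Finset.univ.filter fun j => w j ≠ 0).card
    using Nat.strong_induction_on generalizing w with
  | _ k ih =>
  set S := Finset.univ.filter fun j => w j ≠ 0 with hS
  by_cases hcard : S.card ≤ Fintype.card m
  · exact ⟨w, hw, rfl, le_rfl, S, hcard, fun j => by simp [hS], fun j => by simp [hS]⟩
  · have hker : LinearMap.ker (A.mulVecLin ∘ₗ
        Function.ExtendByZero.linearMap ℝ (fun j : S => j.1)) ≠ ⊥ :=
      LinearMap.ker_ne_bot_of_finrank_lt (by simpa using hcard)
    obtain ⟨e, he, he0⟩ := Submodule.exists_mem_ne_zero_of_ne_bot hker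
    obtain ⟨d, hdA, hd0, hdS⟩ : ∃ d : N → ℝ, A *ᵥ d = 0 ∧ d ≠ 0 ∧ ∀ j, j ∉ S → d j = 0 := by
      refine ⟨Function.ExtendByZero.linearMap ℝ (fun j : S => j.1) e, LinearMap.mem_ker.mp he,
        fun h => he0 ?_, fun j hj => ?_⟩
      · ext j
        have := congrFun h j.1
        simpa [Subtype.val_injective.extend_apply] using this
      · simp only [Function.ExtendByZero.linearMap_apply]
        rw [Function.extend_apply']
        · rfl
        · rintro ⟨a, rfl⟩
          exact hj a.2
    obtain ⟨δ, hδA, hδ0, hδS, hδc⟩ : ∃ d : N → ℝ, A *ᵥ d = 0 ∧ d ≠ 0 ∧ (∀ j, j ∉ S → d j = 0) ∧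
        c ⬝ᵥ d ≤ 0 := by
      rcases le_total (c ⬝ᵥ d) 0 with h | h
      · exact ⟨d, hdA, hd0, hdS, h⟩
      · refine ⟨-d, by rw [mulVec_neg, hdA, neg_zero], neg_ne_zero.mpr hd0, fun j hj => ?_, ?_⟩
        · rw [Pi.neg_apply, hdS j hj, neg_zero]
        · rw [dotProduct_neg]
          linarith
    -- Otherwise `δ` would be a nonzero recession direction, excluded by `hA`.
    have hneg : ∃ j, δ j < 0 := by
      by_contra h
      push Not at h
      exact hδ0 (hA δ h hδA)
    obtain ⟨t, ht, hnonneg, j, hj, hj0⟩ := exists_ratio_step hw hneg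
    have hzero : ∀ i, w i = 0 → (w + t • δ) i = 0 := fun i hi => by
      rw [Pi.add_apply, hi, Pi.smul_apply, hδS i (by simpa [hS] using hi), smul_zero, add_zero]
    obtain ⟨w', h1, h2, h3, S', h4, h5, h6⟩ := ih _ (by
      rw [← hk]
      refine Finset.card_lt_card (Finset.ssubset_iff_of_subset (fun i hi => ?_) |>.mpr ⟨j, ?_, ?_⟩)
      · simp only [Finset.mem_filter, Finset.mem_univ, true_and, hS] at hi ⊢
        exact fun h => hi (hzero i h)
      · by_contra h
        exact hj.ne (hδS j h)
      · simpa using hj0) (w + t • δ) hnonneg rfl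
    refine ⟨w', h1, ?_, ?_, S', h4, h5, fun j hj hw0 => h6 j hj (hzero j hw0)⟩
    · rw [h2, mulVec_add, mulVec_smul, hδA, smul_zero, add_zero]
    · rw [dotProduct_add, dotProduct_smul, smul_eq_mul] at h3
      have := mul_nonpos_of_nonneg_of_nonpos ht hδc
      linarith

/-- A polyhedron has finitely many extreme points. -/
theorem finite_extremePoints (A : Matrix N m ℝ) (b : N → ℝ) :
    (Set.extremePoints ℝ {p : m → ℝ | A *ᵥ p ≤ b}).Finite := by
  classical
  refine Set.Finite.of_injOn (t := Set.univ) (f := fun p => {i : N | (A *ᵥ p) i = b i})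
    (fun _ _ => Set.mem_univ _) ?_ Set.finite_univ
  intro p hp q hq hpq
  by_contra hne
  -- If `p` and `q` have the same tight constraints, then `p` can be moved a little both ways along
  -- `p - q`, against extremality.
  obtain ⟨t, ht, hadd, hsub⟩ : ∃ t : ℝ, 0 < t ∧ A *ᵥ (p + t • (p - q)) ≤ b ∧
      A *ᵥ (p - t • (p - q)) ≤ b := by
    have hpb : A *ᵥ p ≤ b := hp.1
    have hloc : ∀ i, ∃ t : ℝ, 0 < t ∧ ∀ s, 0 ≤ s → s ≤ t →
        (A *ᵥ p) i + s * |(A *ᵥ (p - q)) i| ≤ b i := fun i => by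
      by_cases hi : (A *ᵥ p) i = b i
      · have hi' : (A *ᵥ q) i = b i := (Set.ext_iff.mp hpq i).mp hi
        refine ⟨1, one_pos, fun s _ _ => ?_⟩
        rw [mulVec_sub, Pi.sub_apply, hi, hi', sub_self, abs_zero, mul_zero, add_zero]
      · have hlt : (A *ᵥ p) i < b i := lt_of_le_of_ne (hpb i) hi
        have hpos : 0 < |(A *ᵥ (p - q)) i| + 1 := by positivity
        refine ⟨(b i - (A *ᵥ p) i) / (|(A *ᵥ (p - q)) i| + 1), div_pos (sub_pos.mpr hlt) hpos,
          fun s hs hst => ?_⟩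
        rw [le_div_iff₀ hpos] at hst
        linarith
    choose τ hτ hτb using hloc
    obtain ⟨t, ht, htτ⟩ : ∃ t : ℝ, 0 < t ∧ ∀ i, t ≤ τ i := by
      rcases isEmpty_or_nonempty N with h | h
      · exact ⟨1, one_pos, fun i => h.elim i⟩
      · obtain ⟨i, hi⟩ := Finite.exists_min τ
        exact ⟨τ i, hτ i, hi⟩
    refine ⟨t, ht, fun i => ?_, fun i => ?_⟩
    · have h1 := hτb i t ht.le (htτ i)
      have h2 := mul_le_mul_of_nonneg_left (le_abs_self ((A *ᵥ (p - q)) i)) ht.le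
      rw [mulVec_add, mulVec_smul, Pi.add_apply, Pi.smul_apply, smul_eq_mul]
      linarith
    · have h1 := hτb i t ht.le (htτ i)
      have h2 := mul_le_mul_of_nonneg_left (neg_abs_le ((A *ᵥ (p - q)) i)) ht.le
      rw [mulVec_sub, mulVec_smul, Pi.sub_apply, Pi.smul_apply, smul_eq_mul]
      linarith
  have := hp.2 hadd hsub ⟨1 / 2, 1 / 2, by norm_num, by norm_num, by norm_num, by module⟩
  have h0 : t • (p - q) = 0 := by simpa using this
  exact hne (sub_eq_zero.mp ((smul_eq_zero.mp h0).resolve_left ht.ne'))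

/-- The sets of `card m` indices (columns of `[F I]`) on which some dual feasible reduced cost
vector `(Fᵀ p + q, p)` vanishes. -/
def dualFeasibleSets (F : Matrix m n ℝ) (q : n → ℝ) : Set (Finset (n ⊕ m)) :=
  {B | B.card = Fintype.card m ∧ ∃ p : m → ℝ, 0 ≤ p ∧ 0 ≤ Fᵀ *ᵥ p + q ∧
    (∀ j, Sum.inl j ∈ B → (Fᵀ *ᵥ p + q) j = 0) ∧ ∀ i, Sum.inr i ∈ B → p i = 0}

/-- The dual polyhedron is pointed, because `p ≥ 0` is among its constraints, so `p` moves within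
its face to a point with enough tight constraints; `Z` collects these. No linear independence is
asked of the subsets of `Z`. -/
theorem exists_dualFeasibleSet (F : Matrix m n ℝ) {q : n → ℝ} {p : m → ℝ} (hp : 0 ≤ p)
    (hd : 0 ≤ Fᵀ *ᵥ p + q) : ∃ Z : Finset (n ⊕ m), Fintype.card m ≤ Z.card ∧
      (∀ j, (Fᵀ *ᵥ p + q) j = 0 → Sum.inl j ∈ Z) ∧ (∀ i, p i = 0 → Sum.inr i ∈ Z) ∧
      ∀ B ⊆ Z, B.card = Fintype.card m → B ∈ dualFeasibleSets F q := by
  classical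
  have hexp : ∀ p : m → ℝ, (fromCols F 1)ᵀ *ᵥ p + Sum.elim q 0 = Sum.elim (Fᵀ *ᵥ p + q) p := by
    intro p
    rw [transpose_fromCols, fromRows_mulVec, transpose_one, one_mulVec]
    ext (i | i) <;> simp
  obtain ⟨p', h1, h2, Z, h3, h4⟩ := exists_vertex (fromCols F (1 : Matrix m m ℝ)) (Sum.elim q 0)
    (fun μ hμ => by
      rw [transpose_fromCols, fromRows_mulVec, transpose_one, one_mulVec] at hμ
      ext i
      exact congrFun hμ (Sum.inr i)) p (by
      rw [hexp]
      rintro (i | i)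
      · exact hd i
      · exact hp i)
  rw [hexp] at h1
  simp only [hexp] at h2 h4
  exact ⟨Z, h3, fun j hj => (h4 _).mpr (h2 (Sum.inl j) hj),
    fun i hi => (h4 _).mpr (h2 (Sum.inr i) hi), fun B hB hBc => ⟨hBc, p', fun i => h1 (Sum.inr i),
      fun j => h1 (Sum.inl j), fun j hj => (h4 _).mp (hB hj), fun i hi => (h4 _).mp (hB hi)⟩⟩

theorem dualFeasibleSets_nonempty (F : Matrix m n ℝ) {q : n → ℝ} {p : m → ℝ} (hp : 0 ≤ p)
    (hd : 0 ≤ Fᵀ *ᵥ p + q) : (dualFeasibleSets F q).Nonempty := by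
  obtain ⟨Z, hZ, -, -, h⟩ := exists_dualFeasibleSet F hp hd
  obtain ⟨B, hB, hBc⟩ := Finset.exists_subset_card_eq hZ
  exact ⟨B, h B hB hBc⟩

/-- If every dual feasible index set for the cost `q₁` is one for the cost `q₂`, then every optimal
solution of `min {q₁ u : F u ≤ r, u ≥ 0}` also minimizes `q₂ u`. -/
theorem optimal_of_dualFeasibleSets_subset (F : Matrix m n ℝ)
    (hF : ∀ d : n → ℝ, 0 ≤ d → F *ᵥ d ≤ 0 → d = 0) {q₁ q₂ : n → ℝ}
    (hsub : dualFeasibleSets F q₁ ⊆ dualFeasibleSets F q₂) {r : m → ℝ} {u u' : n → ℝ} {p : m → ℝ}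
    (hu : 0 ≤ u) (hr : 0 ≤ r - F *ᵥ u) (hp : 0 ≤ p) (hd : 0 ≤ Fᵀ *ᵥ p + q₁)
    (hs : ∀ i, p i * (r - F *ᵥ u) i = 0) (hz : ∀ j, u j * (Fᵀ *ᵥ p + q₁) j = 0)
    (hu' : 0 ≤ u') (hr' : 0 ≤ r - F *ᵥ u') : q₂ ⬝ᵥ u ≤ q₂ ⬝ᵥ u' := by
  classical
  obtain ⟨Z, hZ, hZl, hZr, hZB⟩ := exists_dualFeasibleSet F hp hd
  -- The cost is `-q₂`, so the reduced point is no better than `u` for `q₂`. Its optimality for `q₂`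
  -- will therefore imply that of `u`.
  obtain ⟨w, hw, hAw, hqw, S, hS, hwS, hSu⟩ := exists_small_support
    (fromCols F (1 : Matrix m m ℝ)) (-Sum.elim q₂ 0) (fun d hd0 hAd => by
      have hl : (fun j => d (Sum.inl j)) = 0 := hF _ (fun j => hd0 _) fun i => by
        have h1 := congrFun hAd i
        have h2 : 0 ≤ d (Sum.inr i) := hd0 _
        rw [fromCols_mulVec, one_mulVec, Pi.add_apply] at h1
        simp only [Pi.zero_apply, Function.comp_apply] at h1 ⊢
        have h3 : (F *ᵥ fun j => d (Sum.inl j)) i = (F *ᵥ (d ∘ Sum.inl)) i := rfl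
        linarith
      have hl' : d ∘ Sum.inl = 0 := hl
      rw [fromCols_mulVec, one_mulVec, hl', mulVec_zero, zero_add] at hAd
      ext (j | i)
      · exact congrFun hl j
      · exact congrFun hAd i) (Sum.elim u (r - F *ᵥ u)) (by
      rintro (i | i)
      · exact hu i
      · exact hr i)
  have hSZ : S ⊆ Z := by
    rintro (j | i) hj
    · exact hZl j ((mul_eq_zero.mp (hz j)).resolve_left (hSu _ hj))
    · exact hZr i ((mul_eq_zero.mp (hs i)).resolve_right (hSu _ hj))
  -- `B ⊆ Z` makes `B` dual feasible for `q₁`, hence for `q₂`; `S ⊆ B` makes the reduced point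
  -- complementary to the resulting multiplier `p₂`.
  obtain ⟨B, hSB, hBZ, hB⟩ := Finset.exists_subsuperset_card_eq hSZ hS hZ
  obtain ⟨-, p₂, hp₂, hd₂, hBl, hBr⟩ := hsub (hZB B hBZ hB)
  obtain ⟨v, s, rfl⟩ : ∃ v s, w = Sum.elim v s :=
    ⟨fun i => w (Sum.inl i), fun j => w (Sum.inr j), by ext (i | j) <;> rfl⟩
  have hsv : r - F *ᵥ v = s := by
    rw [fromCols_mulVec_sumElim, fromCols_mulVec_sumElim, one_mulVec, one_mulVec,
      add_sub_cancel] at hAw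
    rw [← hAw]
    abel
  have hle : q₂ ⬝ᵥ u ≤ q₂ ⬝ᵥ v := by
    simpa [sumElim_dotProduct_sumElim] using hqw
  refine hle.trans (optimal_of_complementary F hp₂ hd₂ (fun i => ?_) (fun j => ?_) hu' hr')
  · rw [hsv]
    by_cases h : s i = 0
    · rw [h, mul_zero]
    · rw [hBr i (hSB (hwS (Sum.inr i) h)), zero_mul]
  · by_cases h : v j = 0
    · rw [h, zero_mul]
    · rw [hBl j (hSB (hwS (Sum.inl j) h)), mul_zero]

end LinearProgram

namespace TwoStageRO

variable {nx mx mA nu mu muu ny muy : ℕ} (P : TwoStageRO nx mx mA nu mu muu ny muy)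

/-! ### Finiteness of the set of possible `β`. -/

theorem finite_extremePts : P.extremePts.Finite := by
  have h := LinearProgram.finite_extremePoints
    (fromRows (-1 : Matrix (Fin muy) (Fin muy) ℝ) P.B₂ᵀ) (Sum.elim 0 P.c₂)
  have heq : P.dualPolyhedron = {p : Fin muy → ℝ | fromRows (-1 : Matrix (Fin muy) (Fin muy) ℝ)
      P.B₂ᵀ *ᵥ p ≤ Sum.elim (0 : Fin muy → ℝ) P.c₂} := by
    ext p
    rw [Set.mem_ofPred_eq, fromRows_mulVec, Sum.elim_le_elim_iff, neg_mulVec, one_mulVec,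
      neg_nonpos]
    rfl
  rwa [← heq] at h

theorem finite_extremeRays : P.extremeRays.Finite := by
  have h := LinearProgram.finite_extremePoints
    (fromRows (fromRows (-1 : Matrix (Fin muy) (Fin muy) ℝ) P.B₂ᵀ)
      (fromRows (replicateRow Unit (1 : Fin muy → ℝ)) (-replicateRow Unit (1 : Fin muy → ℝ))))
    (Sum.elim (Sum.elim 0 0) (Sum.elim 1 (-1)))
  rw [extremeRays]
  convert h using 3
  funext p
  have hsum : (replicateRow Unit (1 : Fin muy → ℝ)) *ᵥ p = fun _ => ∑ i, p i := by
    ext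
    simp [mulVec, dotProduct]
  simp only [fromRows_mulVec, Sum.elim_le_elim_iff, neg_mulVec, one_mulVec,
    neg_nonpos, hsum, neg_le_neg_iff, and_assoc]
  exact propext (and_congr_right fun _ => and_congr_right fun _ =>
    ⟨fun h => ⟨fun _ => h.le, fun _ => h.ge⟩, fun h => le_antisymm (h.1 ()) (h.2 ())⟩)

/-! ### Duality for the recourse problem -/

variable {P}

theorem rhs_dotProduct_le {x : Fin nx ⊕ Fin mx → ℝ} {u : (Fin nu → ℝ) × (Fin mu → ℕ)}
    {p : Fin muy → ℝ} {y : Fin ny → ℝ} (hp : p ∈ P.dualPolyhedron) (hy : y ∈ P.Y x u) :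
    P.rhs x u ⬝ᵥ p ≤ P.c₂ ⬝ᵥ y :=
  LinearProgram.weak_duality P.B₂ hy.1 hy.2 hp.1 hp.2

theorem rhs_dotProduct_nonpos_of_mem_extremeRays {x : Fin nx ⊕ Fin mx → ℝ}
    {u : (Fin nu → ℝ) × (Fin mu → ℕ)} {g : Fin muy → ℝ} {y : Fin ny → ℝ}
    (hg : g ∈ P.extremeRays) (hy : y ∈ P.Y x u) : P.rhs x u ⬝ᵥ g ≤ 0 := by
  have := LinearProgram.weak_duality P.B₂ hy.1 hy.2 hg.1.1 hg.1.2.1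
  rwa [zero_dotProduct] at this

/-- If the dual of the recourse problem has an optimal solution, then so has the recourse problem,
with the same value. -/
theorem exists_mem_Y_of_dual_optimal {x : Fin nx ⊕ Fin mx → ℝ}
    {u : (Fin nu → ℝ) × (Fin mu → ℕ)} {p : Fin muy → ℝ} (hp : p ∈ P.dualPolyhedron)
    (hmax : ∀ q ∈ P.dualPolyhedron, P.rhs x u ⬝ᵥ q ≤ P.rhs x u ⬝ᵥ p) :
    ∃ y ∈ P.Y x u, P.c₂ ⬝ᵥ y ≤ P.rhs x u ⬝ᵥ p := by
  obtain ⟨y₀, hy₀, hy₀'⟩ := LinearProgram.farkas P.B₂ (P.rhs x u) (by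
    intro g hg hBg
    have := hmax (p + g) ⟨add_nonneg hp.1 hg, by
      rw [mulVec_add]
      simpa using add_le_add hp.2 hBg⟩
    rw [dotProduct_add] at this
    linarith)
  obtain ⟨y, q, hy, hBy, hq, hBq, heq⟩ :=
    LinearProgram.strong_duality P.B₂ hy₀ hy₀' hp.1 hp.2
  exact ⟨y, ⟨hy, hBy⟩, heq.trans_le (hmax q ⟨hq, hBq⟩)⟩

/-- A feasible recourse problem that is bounded below has an optimal solution. -/
theorem exists_optimal_recourse {x : Fin nx ⊕ Fin mx → ℝ} {u : (Fin nu → ℝ) × (Fin mu → ℕ)}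
    {r : ℝ} (hne : (P.Y x u).Nonempty) (hr : ∀ y ∈ P.Y x u, r ≤ P.c₂ ⬝ᵥ y) :
    ∃ y ∈ P.Y x u, ((P.c₂ ⬝ᵥ y : ℝ) : EReal) ≤ P.recourse x u := by
  obtain ⟨y₀, hy₀⟩ := hne
  -- If the dual were infeasible, a recession direction `v` with `c₂ · v < 0` would push the cost
  -- below `r`.
  obtain ⟨p₀, hp₀, hp₀'⟩ := LinearProgram.farkas (-P.B₂ᵀ) (-P.c₂) (by
    intro v hv hBv
    rw [transpose_neg, transpose_transpose, neg_mulVec, neg_nonpos] at hBv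
    rw [neg_dotProduct, neg_nonpos]
    by_contra! hneg
    obtain ⟨t, ht⟩ := exists_nat_gt ((P.c₂ ⬝ᵥ y₀ - r) / -(P.c₂ ⬝ᵥ v))
    rw [div_lt_iff₀ (by linarith)] at ht
    have hy : y₀ + (t : ℝ) • v ∈ P.Y x u := by
      refine ⟨add_nonneg hy₀.1 (smul_nonneg t.cast_nonneg hv), ?_⟩
      rw [mulVec_add, mulVec_smul]
      exact le_add_of_le_of_nonneg hy₀.2 (smul_nonneg t.cast_nonneg hBv)
    have := hr _ hy
    rw [dotProduct_add, dotProduct_smul, smul_eq_mul] at this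
    linarith)
  rw [neg_mulVec, neg_le_neg_iff] at hp₀'
  obtain ⟨y, q, hy, hBy, hq, hBq, heq⟩ :=
    LinearProgram.strong_duality P.B₂ hy₀.1 hy₀.2 hp₀ hp₀'
  refine ⟨y, ⟨hy, hBy⟩, le_iInf₂ fun y' hy' => EReal.coe_le_coe_iff.mpr ?_⟩
  rw [heq]
  exact rhs_dotProduct_le ⟨hq, hBq⟩ hy'

theorem nonempty_Y_of_worst_ne_top {x : Fin nx ⊕ Fin mx → ℝ} (h : P.worst x ≠ ⊤)
    {u : (Fin nu → ℝ) × (Fin mu → ℕ)} (hu : u ∈ P.U x) : (P.Y x u).Nonempty := by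
  by_contra hne
  rw [Set.not_nonempty_iff_eq_empty] at hne
  have h1 : P.recourse x u ≤ P.worst x := le_iSup₂ (f := fun u _ => P.recourse x u) u hu
  rw [recourse, hne] at h1
  simp only [Set.mem_empty_iff_false, iInf_false, iInf_top, top_le_iff] at h1
  exact h h1

/-- With `x` and `u_d` fixed only the term `-E_c u_c` varies, so minimizing `(E_cᵀ β) · u` maximizes
the dual value at `β`. -/
theorem rhs_dotProduct_mono {x : Fin nx ⊕ Fin mx → ℝ} {ud : Fin mu → ℕ} {u u' : Fin nu → ℝ}
    {β : Fin muy → ℝ} (h : (P.Ecᵀ *ᵥ β) ⬝ᵥ u ≤ (P.Ecᵀ *ᵥ β) ⬝ᵥ u') :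
    P.rhs x (u', ud) ⬝ᵥ β ≤ P.rhs x (u, ud) ⬝ᵥ β := by
  have e : ∀ u, (P.Ec *ᵥ u) ⬝ᵥ β = (P.Ecᵀ *ᵥ β) ⬝ᵥ u := fun u => by
    rw [dotProduct_comm, dotProduct_mulVec, mulVec_transpose]
  simp only [rhs, sub_dotProduct, e]
  linarith

/-! ### The Karush-Kuhn-Tucker systems -/

/-- The recession cone depends on `F_c` alone, so one nonempty bounded `U(x₀)` settles every `x`,
even outside `X`. -/
theorem eq_zero_of_recession (hRHS : P.RHSDependent) (hA1 : P.NonemptyUncertainty)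
    (hA2 : P.BoundedUncertainty) {x₀ : Fin nx ⊕ Fin mx → ℝ} (hx₀ : x₀ ∈ P.X)
    (x : Fin nx ⊕ Fin mx → ℝ) {d : Fin nu → ℝ} (hd : 0 ≤ d) (hFd : P.Fc x *ᵥ d ≤ 0) : d = 0 := by
  rw [(hRHS x x₀).1] at hFd
  obtain ⟨u, hu, hud, hs⟩ := hA1 x₀ hx₀
  obtain ⟨K, hK⟩ := hA2 x₀ hx₀
  ext j
  refine le_antisymm ?_ (hd j)
  by_contra! hj
  simp only [Pi.zero_apply] at hj
  obtain ⟨t, ht⟩ := exists_nat_gt (K / d j)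
  rw [div_lt_iff₀ hj] at ht
  have h1 := hK (u.1 + (t : ℝ) • d, u.2) ⟨add_nonneg hu (smul_nonneg t.cast_nonneg hd), hud, by
    have e : P.slack x₀ u.2 (u.1 + (t : ℝ) • d) =
        P.slack x₀ u.2 u.1 + (t : ℝ) • -(P.Fc x₀ *ᵥ d) := by
      simp only [slack, mulVec_add, mulVec_smul, smul_neg]
      abel
    exact e ▸ add_nonneg hs (smul_nonneg t.cast_nonneg (neg_nonneg.mpr hFd))⟩ j
  have h2 : 0 ≤ u.1 j := hu j
  simp only [Pi.add_apply, Pi.smul_apply, smul_eq_mul] at h1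
  linarith

theorem exists_multiplier {F : Matrix (Fin muu) (Fin nu) ℝ}
    (hF : ∀ d : Fin nu → ℝ, 0 ≤ d → F *ᵥ d ≤ 0 → d = 0) (q : Fin nu → ℝ) :
    ∃ p : Fin muu → ℝ, 0 ≤ p ∧ 0 ≤ Fᵀ *ᵥ p + q := by
  obtain ⟨p, hp, hq⟩ := LinearProgram.farkas Fᵀ (-q) (by
    intro d hd hFd
    rw [transpose_transpose] at hFd
    rw [hF d hd hFd, dotProduct_zero])
  exact ⟨p, hp, neg_le_iff_add_nonneg.mp hq⟩

variable (P) in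
/-- The penalty `M` is exact: the KKT system of `LP(x, u_d, β)` is solvable, and all its solutions
have `ũ = 0` if `u_d` can be completed to a scenario of `U(x)`. -/
def ExactPenalty (M : ℝ) : Prop :=
  ∀ β ∈ P.extremePts ∪ P.extremeRays, ∀ x ud, (P.OU M x ud β).Nonempty ∧
    ∀ u₀ : Fin nu → ℝ, 0 ≤ u₀ → 0 ≤ P.slack x ud u₀ → ∀ w ∈ P.OU M x ud β, w.2.1 = 0

theorem exists_exactPenalty (hRHS : P.RHSDependent) (hA1 : P.NonemptyUncertainty)
    (hA2 : P.BoundedUncertainty) {x₀ : Fin nx ⊕ Fin mx → ℝ} (hx₀ : x₀ ∈ P.X) :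
    ∃ M₀ : ℝ, ∀ M, M₀ ≤ M → P.ExactPenalty M := by
  obtain ⟨M₀, hM₀⟩ := LinearProgram.exists_exact_penalty (P.Fc x₀)
    ((P.finite_extremePts.union P.finite_extremeRays).image fun β => P.Ecᵀ *ᵥ β)
    (fun q _ => exists_multiplier (fun d => eq_zero_of_recession hRHS hA1 hA2 hx₀ x₀) q)
  refine ⟨M₀, fun M hM β hβ x ud => ?_⟩
  obtain ⟨⟨p, hp, hpM, hd⟩, hexact⟩ := hM₀ M hM _ (Set.mem_image_of_mem _ hβ)
  rw [(hRHS x₀ x).1] at hd hexact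
  constructor
  · obtain ⟨u, v, p, h⟩ := LinearProgram.exists_penalty_kkt (P.Fc x) (P.Ecᵀ *ᵥ β)
      (P.h + P.G *ᵥ x - P.Fd x *ᵥ toReal ud) hp hpM hd
    exact ⟨(u, v, p), h⟩
  · rintro u₀ hu₀ hs₀ ⟨u, v, p⟩ ⟨h1, h2, h3, h4, -, h5, h6, h7, h8⟩
    exact hexact (P.h + P.G *ᵥ x - P.Fd x *ᵥ toReal ud) u₀ u v p hu₀ hs₀ h1 h2 h3 h4 h5 h6 h7 h8

/-! ### Bounds from the master problem -/

theorem masterFeasible_mono {M : ℝ} {D D' : Set (Cut mu muy)} (h : D ⊆ D')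
    {p : MasterPoint nx mx nu mu muu ny muy} (hp : P.MasterFeasible M D' p) :
    P.MasterFeasible M D p :=
  ⟨hp.1, fun c hc => hp.2 c (h hc)⟩

/-- The master problem is a relaxation of the two-stage problem. -/
theorem masterObj_le_objective (hA3 : P.MonolithicBounded) {M : ℝ} (hM : P.ExactPenalty M)
    {D : Set (Cut mu muy)} (hD : ∀ c ∈ D, c.1 ∈ P.Ud ∧ c.2 ∈ P.extremePts ∪ P.extremeRays)
    {p : MasterPoint nx mx nu mu muu ny muy} (hp : P.MasterOptimal M D p)
    {x : Fin nx ⊕ Fin mx → ℝ} (hx : x ∈ P.X) : P.masterObj p ≤ P.objective x := by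
  classical
  by_cases htop : P.worst x = ⊤
  · rw [objective, htop, EReal.coe_add_top]
    exact le_top
  obtain ⟨r, hr⟩ := hA3
  have hw : ∀ c : Cut mu muy, ∃ w, c ∈ D → w ∈ P.OU M x c.1 c.2 := fun c => by
    by_cases hc : c ∈ D
    · obtain ⟨w, hw⟩ := (hM c.2 (hD c hc).2 x c.1).1
      exact ⟨w, fun _ => hw⟩
    · exact ⟨0, fun h => absurd h hc⟩
  choose w hw using hw
  have hy : ∀ c : Cut mu muy, ∃ y : Fin ny → ℝ, 0 ≤ y ∧ (c ∈ D → (w c).2.1 = 0 →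
      ((P.c₂ ⬝ᵥ y : ℝ) : EReal) ≤ P.worst x ∧ P.rhs x ((w c).1, c.1) ≤ P.B₂ *ᵥ y) := fun c => by
    by_cases hc : c ∈ D ∧ (w c).2.1 = 0
    · have hOU := hw c hc.1
      have hU : ((w c).1, c.1) ∈ P.U x := by
        refine ⟨hOU.1, (hD c hc.1).1, ?_⟩
        have := hOU.2.2.1
        rwa [hc.2, add_zero] at this
      obtain ⟨y, hy, hle⟩ := exists_optimal_recourse (r := r - P.c₁ ⬝ᵥ x)
        (nonempty_Y_of_worst_ne_top htop hU) (fun y hy => by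
          have := hr x hx _ hU y hy
          linarith)
      exact ⟨y, hy.1, fun _ _ => ⟨hle.trans (le_iSup₂ (f := fun u _ => P.recourse x u) _ hU),
        hy.2⟩⟩
    · exact ⟨0, le_rfl, fun h1 h2 => absurd ⟨h1, h2⟩ hc⟩
  choose y hy0 hy using hy
  -- A KKT point with `ũ = 0` is a scenario of `U(x)`, so `η = worst x` dominates its recourse cost.
  -- Where `ũ ≠ 0` the recourse constraints are off and `y = 0` serves.
  exact hp.2 ⟨x, P.worst x, fun c => (w c).1, fun c => (w c).2.1, fun c => (w c).2.2, y⟩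
    ⟨hx, fun c hc => ⟨hw c hc, hy0 c, hy c hc⟩⟩

/-- If a scenario `u_d` is generated again, with `β`, while the master solution contains a point of
`U(x | u_d)` that is optimal for `β`, then the iteration closes the gap. -/
theorem worst_le_of_optimal_for_cut {M : ℝ} {D : Set (Cut mu muy)}
    {it : Iteration nx mx nu mu muu ny muy} (hit : P.IsIteration M D it) {c : Cut mu muy}
    (hc : c ∈ D) (hud : c.1 = it.cut.1) (hut : it.sol.ut c = 0)
    (hopt : ∀ u' : Fin nu → ℝ, 0 ≤ u' → 0 ≤ P.slack it.sol.x c.1 u' →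
      (P.Ecᵀ *ᵥ it.cut.2) ⬝ᵥ it.sol.uc c ≤ (P.Ecᵀ *ᵥ it.cut.2) ⬝ᵥ u') :
    it.etaO = P.worst it.sol.x ∧ P.objective it.sol.x ≤ P.masterObj it.sol ∧
      ∀ u ∈ P.U it.sol.x, (P.Y it.sol.x u).Nonempty := by
  obtain ⟨⟨⟨-, hfeas⟩, -⟩, hcase⟩ := hit
  obtain ⟨-, hy0, hy⟩ := hfeas c hc
  obtain ⟨heta, hrhs⟩ := hy hut
  have hY : it.sol.y c ∈ P.Y it.sol.x (it.sol.uc c, c.1) := ⟨hy0, hrhs⟩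
  rcases hcase with ⟨-, ⟨uc, hU, hworst, hext, hmax⟩, hetaO⟩ | ⟨-, ⟨uc, ⟨hU, -⟩, hray, hpos⟩, -⟩
  · obtain ⟨y, hyY, hyle⟩ := exists_mem_Y_of_dual_optimal hext.1 hmax
    rw [← hud] at hU hworst hyY hyle
    -- The chain is: worst cost = dual value of `β*` at the generated scenario ≤ dual value at the
    -- cut's point ≤ cost of the cut's `y` ≤ `η`.
    have h1 := rhs_dotProduct_mono (x := it.sol.x) (ud := c.1) (hopt uc hU.1 hU.2.2)
    have h2 := rhs_dotProduct_le hext.1 hY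
    have h3 : P.recourse it.sol.x (uc, c.1) ≤ ((P.c₂ ⬝ᵥ y : ℝ) : EReal) := iInf₂_le y hyY
    have h4 : P.worst it.sol.x ≤ ((P.c₂ ⬝ᵥ it.sol.y c : ℝ) : EReal) :=
      hworst ▸ h3.trans (EReal.coe_le_coe_iff.mpr (by linarith))
    exact ⟨hetaO, add_le_add_right (h4.trans heta) _, fun u hu =>
      nonempty_Y_of_worst_ne_top (ne_top_of_le_ne_top (EReal.coe_ne_top _) h4) hu⟩
  -- For a ray the dual value at the cut's point would be positive, although that point has a
  -- feasible recourse.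
  · rw [← hud] at hU hpos
    have h1 := rhs_dotProduct_mono (x := it.sol.x) (ud := c.1) (hopt uc hU.1 hU.2.2)
    have h2 := rhs_dotProduct_nonpos_of_mem_extremeRays hray hY
    linarith

/-! ### Runs of the algorithm -/

theorem IsIteration.cut_spec {M : ℝ} {D : Set (Cut mu muy)}
    {it : Iteration nx mx nu mu muu ny muy} (hit : P.IsIteration M D it) :
    it.cut.2 ∈ P.extremePts ∪ P.extremeRays ∧ ∃ uc, (uc, it.cut.1) ∈ P.U it.sol.x := by
  rcases hit.2 with ⟨-, ⟨uc, h⟩, -⟩ | ⟨-, ⟨uc, h1, h2⟩, -⟩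
  · exact ⟨Or.inl h.2.2.1, uc, h.1⟩
  · exact ⟨Or.inr h2.1, uc, h1.1⟩

theorem IsRun.cuts_spec {M : ℝ} {T : ℕ} {it : ℕ → Iteration nx mx nu mu muu ny muy}
    (hrun : P.IsRun M T it) {t : ℕ} (ht : t ≤ T) {c : Cut mu muy} (hc : c ∈ cuts it t) :
    c.1 ∈ P.Ud ∧ c.2 ∈ P.extremePts ∪ P.extremeRays := by
  obtain ⟨s, hs, hst, rfl⟩ := hc
  obtain ⟨h1, uc, h2⟩ := (hrun s hs (hst.le.trans ht)).cut_spec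
  exact ⟨h2.2.1, h1⟩

/-- All cuts of a scenario that can be completed at `xᵗ` have `ũ = 0`. -/
theorem IsRun.ut_eq_zero {M : ℝ} (hM : P.ExactPenalty M) {T : ℕ}
    {it : ℕ → Iteration nx mx nu mu muu ny muy} (hrun : P.IsRun M T it) {t : ℕ} (ht : 1 ≤ t)
    (htT : t ≤ T) {c : Cut mu muy} (hc : c ∈ cuts it t) {u₀ : Fin nu → ℝ} (hu₀ : 0 ≤ u₀)
    (hs₀ : 0 ≤ P.slack (it t).sol.x c.1 u₀) : (it t).sol.ut c = 0 :=
  (hM c.2 (hrun.cuts_spec htT hc).2 (it t).sol.x c.1).2 u₀ hu₀ hs₀ _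
    ((hrun t ht htT).1.1.2 c hc).1

theorem UB_le (it : ℕ → Iteration nx mx nu mu muu ny muy) {s t : ℕ} (hs : 1 ≤ s) (hst : s ≤ t) :
    P.UB it t ≤ ((P.c₁ ⬝ᵥ (it s).sol.x : ℝ) : EReal) + (it s).etaO := by
  induction t, hst using Nat.le_induction with
  | base =>
    obtain ⟨s, rfl⟩ := Nat.exists_eq_add_of_le' hs
    exact min_le_right _ _
  | succ t _ ih => exact (min_le_left _ _).trans ih

theorem IsRun.LB_mono {M : ℝ} {T : ℕ} {it : ℕ → Iteration nx mx nu mu muu ny muy}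
    (hrun : P.IsRun M T it) {s t : ℕ} (hs : 1 ≤ s) (hst : s ≤ t) (ht : t ≤ T) :
    P.LB it s ≤ P.LB it t :=
  have hsub : cuts it s ⊆ cuts it t := by
    rintro c ⟨i, h1, h2, h3⟩
    exact ⟨i, h1, h2.trans_le hst, h3⟩
  (hrun s hs (hst.trans ht)).1.2 _ (masterFeasible_mono hsub (hrun t (hs.trans hst) ht).1.1)

theorem IsRun.stops_and_isOptimal_of_bases_eq (hRHS : P.RHSDependent) (hA3 : P.MonolithicBounded)
    {M : ℝ} (hM : P.ExactPenalty M) {T : ℕ} {it : ℕ → Iteration nx mx nu mu muu ny muy}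
    (hrun : P.IsRun M T it) {t₁ t₂ : ℕ}
    {rec₁ rec₂ : Cut mu muy → Set (Finset (Fin nu ⊕ Fin muu))}
    (h1 : 1 ≤ t₁) (h12 : t₁ < t₂) (h2 : t₂ ≤ T) (hrec₁ : P.IsBasisRecord M it t₁ rec₁)
    (hrec₂ : P.IsBasisRecord M it t₂ rec₂) (hscen : scenarios it t₁ = scenarios it t₂)
    (hbases : ∀ ud ∈ scenarios it t₁,
      basisCollection it t₁ rec₁ ud = basisCollection it t₂ rec₂ ud) :
    P.Stops it t₂ ∧ P.IsOptimal (it t₁).sol.x := by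
  have h1T : t₁ ≤ T := h12.le.trans h2
  have hit := hrun t₁ h1 h1T
  obtain ⟨-, uc, hU⟩ := hit.cut_spec
  have hcut : (it t₁).cut ∈ cuts it t₂ := ⟨t₁, h1, h12, rfl⟩
  have hud : (it t₁).cut.1 ∈ scenarios it t₁ := hscen ▸ ⟨(it t₁).cut.2, hcut⟩
  have hcoll := hbases _ hud
  obtain ⟨β₀, hβ₀⟩ := hud
  have hut₀ := hrun.ut_eq_zero hM h1 h1T hβ₀ hU.1 hU.2.2
  -- Transferring `B₀` from `t₁` to `t₂` only serves to show that the scenario can be completed at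
  -- `x` of iteration `t₂`, so that the new cut has `ũ = 0` there and a basis `B` is recorded for
  -- it.
  obtain ⟨B₀, hB₀⟩ := (hrec₁ _ hβ₀ hut₀).1
  have hB₀' : B₀ ∈ basisCollection it t₁ rec₁ (it t₁).cut.1 := ⟨β₀, hβ₀, hut₀, hB₀⟩
  rw [hcoll] at hB₀'
  obtain ⟨β₁, hβ₁, hut₁, hB₁⟩ := hB₀'
  obtain ⟨-, -, hnonneg, hslack, -⟩ := (hrec₂ _ hβ₁ hut₁).2 _ hB₁
  have hut := hrun.ut_eq_zero hM (h1.trans h12.le) h2 hcut hnonneg hslack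
  obtain ⟨⟨B, hB⟩, hBopt⟩ := hrec₂ _ hcut hut
  have hB' : B ∈ basisCollection it t₂ rec₂ (it t₁).cut.1 := ⟨(it t₁).cut.2, hcut, hut, hB⟩
  rw [← hcoll] at hB'
  obtain ⟨β₂, hβ₂, hut₂, hB₂⟩ := hB'
  obtain ⟨-, ⟨hbc, hbs⟩, -, -, -⟩ := (hrec₁ _ hβ₂ hut₂).2 _ hB₂
  -- `B` is dual feasible for the new `β` by its record at `t₂` and gives the primal point by its
  -- record at `t₁`, possibly for another cut of the same scenario.
  obtain ⟨-, -, -, -, lam, hz, hl, hd, hl0, -⟩ := hBopt B hB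
  rw [(hRHS (it t₂).sol.x (it t₁).sol.x).1] at hz hd
  obtain ⟨hetaO, hle, hY⟩ := worst_le_of_optimal_for_cut hit hβ₂ rfl hut₂ (fun u' hu' hs' =>
    LinearProgram.optimal_of_complementary (P.Fc (it t₁).sol.x)
      (r := P.h + P.G *ᵥ (it t₁).sol.x - P.Fd (it t₁).sol.x *ᵥ toReal (it t₁).cut.1) hl0 hd
      (fun i => by
        by_cases h : Sum.inr i ∈ B
        · rw [hl i h, zero_mul]
        · exact mul_eq_zero_of_right _ (hbs i h))
      (fun j => by
        by_cases h : Sum.inl j ∈ B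
        · rw [hz j h, mul_zero]
        · rw [hbc j h, zero_mul]) hu' hs')
  refine ⟨?_, hit.1.1.1, hY, fun x' hx' => hle.trans
    (masterObj_le_objective hA3 hM (fun c hc => hrun.cuts_spec h1T hc) hit.1 hx')⟩
  calc P.UB it t₂ ≤ ((P.c₁ ⬝ᵥ (it t₁).sol.x : ℝ) : EReal) + (it t₁).etaO := UB_le it h1 h12.le
    _ = P.objective (it t₁).sol.x := by rw [hetaO, objective]
    _ ≤ P.LB it t₁ := hle
    _ ≤ P.LB it t₂ := hrun.LB_mono h1 h12.le h2

/-- The algorithm stops when it generates a scenario for a second time with the same dual feasible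
index sets. -/
theorem IsRun.stops_of_dualFeasibleSets_subset (hRHS : P.RHSDependent)
    (hA1 : P.NonemptyUncertainty) (hA2 : P.BoundedUncertainty) {M : ℝ} (hM : P.ExactPenalty M)
    {T : ℕ} {it : ℕ → Iteration nx mx nu mu muu ny muy} (hrun : P.IsRun M T it) {s t : ℕ}
    (hs : 1 ≤ s) (hst : s < t) (ht : t ≤ T) (hud : (it s).cut.1 = (it t).cut.1)
    (hsub : LinearProgram.dualFeasibleSets (P.Fc (it t).sol.x) (P.Ecᵀ *ᵥ (it s).cut.2) ⊆
      LinearProgram.dualFeasibleSets (P.Fc (it t).sol.x) (P.Ecᵀ *ᵥ (it t).cut.2)) :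
    P.Stops it t := by
  have h1t : 1 ≤ t := hs.trans hst.le
  have hit := hrun t h1t ht
  obtain ⟨-, uc, hU⟩ := hit.cut_spec
  have hcut : (it s).cut ∈ cuts it t := ⟨s, hs, hst, rfl⟩
  rw [← hud] at hU
  have hut := hrun.ut_eq_zero hM h1t ht hcut hU.1 hU.2.2
  obtain ⟨hu, -, hsl, hl, -, hd, hcs, hcz, -⟩ := (hit.1.1.2 _ hcut).1
  simp only [hut, add_zero] at hsl hcs
  obtain ⟨hetaO, hle, -⟩ := worst_le_of_optimal_for_cut hit hcut hud hut (fun u' hu' hs' =>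
    LinearProgram.optimal_of_dualFeasibleSets_subset (P.Fc (it t).sol.x)
      (fun d => eq_zero_of_recession hRHS hA1 hA2 hit.1.1.1 _) hsub
      (r := P.h + P.G *ᵥ (it t).sol.x - P.Fd (it t).sol.x *ᵥ toReal (it s).cut.1)
      hu hsl hl hd hcs hcz hu' hs')
  calc P.UB it t ≤ ((P.c₁ ⬝ᵥ (it t).sol.x : ℝ) : EReal) + (it t).etaO := UB_le it h1t le_rfl
    _ = P.objective (it t).sol.x := by rw [hetaO, objective]
    _ ≤ P.LB it t := hle

theorem IsRun.card_bound (hRHS : P.RHSDependent) (hA1 : P.NonemptyUncertainty)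
    (hA2 : P.BoundedUncertainty) {M : ℝ} (hM : P.ExactPenalty M) {T : ℕ}
    {it : ℕ → Iteration nx mx nu mu muu ny muy} (hrun : P.IsRun M T it) (hX : P.X.Nonempty)
    (hrunning : ∀ t, 1 ≤ t → t ≤ T → ¬ P.Stops it t) :
    T + 1 ≤ P.Ud.card * 2 ^ (nu + muu).choose muu := by
  classical
  obtain ⟨x₀, hx₀⟩ := hX
  -- As `F_c` is constant, evaluating it at `x₀` makes the labels of different iterations
  -- comparable.
  let sets : ℕ → Set (Finset (Fin nu ⊕ Fin muu)) := fun t =>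
    LinearProgram.dualFeasibleSets (P.Fc x₀) (P.Ecᵀ *ᵥ (it t).cut.2)
  have hcard : (Finset.Icc 1 T).card ≤
      -- Removing the empty family saves one label per scenario; since `U_d` is nonempty, this pays
      -- for the `+ 1` in the bound.
      (P.Ud ×ˢ ((Finset.univ : Finset (Fin nu ⊕ Fin muu)).powersetCard muu).powerset.erase
        ∅).card := by
    refine Finset.card_le_card_of_injOn (fun t => ((it t).cut.1, (sets t).toFinset))
      (fun t ht => ?_) (fun s hs t ht hst => ?_)
    · obtain ⟨h1, h2⟩ := Finset.mem_Icc.mp ht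
      obtain ⟨-, uc, hU⟩ := (hrun t h1 h2).cut_spec
      simp only [Finset.coe_product, Set.mem_prod, Finset.mem_coe, Finset.mem_erase,
        Finset.mem_powerset]
      refine ⟨hU.2.1, ?_, fun B hB => ?_⟩
      · obtain ⟨p, hp, hd⟩ := exists_multiplier
          (fun d => eq_zero_of_recession hRHS hA1 hA2 hx₀ x₀ (d := d)) (P.Ecᵀ *ᵥ (it t).cut.2)
        rw [Ne, Set.toFinset_eq_empty]
        exact (LinearProgram.dualFeasibleSets_nonempty _ hp hd).ne_empty
      · rw [Set.mem_toFinset] at hB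
        exact Finset.mem_powersetCard.mpr ⟨Finset.subset_univ _, by simpa using hB.1⟩
    · obtain ⟨hs1, hs2⟩ := Finset.mem_Icc.mp hs
      obtain ⟨ht1, ht2⟩ := Finset.mem_Icc.mp ht
      obtain ⟨hud, hsets⟩ := Prod.mk.inj hst
      rw [Set.toFinset_inj] at hsets
      have key : ∀ {a b}, 1 ≤ a → b ≤ T → a < b → (it a).cut.1 = (it b).cut.1 →
          sets a = sets b → False := fun {a b} ha hb hab h1 h2 =>
        hrunning b (ha.trans hab.le) hb (hrun.stops_of_dualFeasibleSets_subset hRHS hA1 hA2 hM ha hab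
          hb h1 (by
            rw [(hRHS (it b).sol.x x₀).1]
            exact h2.le))
      rcases lt_trichotomy s t with h | h | h
      · exact (key hs1 ht2 h hud hsets).elim
      · exact h
      · exact (key ht1 hs2 h hud.symm hsets.symm).elim
  rw [Nat.card_Icc, Finset.card_product, Finset.card_erase_of_mem (Finset.empty_mem_powerset _),
    Finset.card_powerset, Finset.card_powersetCard, Finset.card_univ, Fintype.card_sum,
    Fintype.card_fin, Fintype.card_fin, Nat.mul_sub, mul_one] at hcard
  obtain ⟨u, hu⟩ := hA1 x₀ hx₀
  have hUd : 1 ≤ P.Ud.card := Finset.card_pos.mpr ⟨u.2, hu.2.1⟩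
  have hle : P.Ud.card ≤ P.Ud.card * 2 ^ (nu + muu).choose muu :=
    Nat.le_mul_of_pos_right _ (by positivity)
  omega

end TwoStageRO

theorem mainTheorem7 {nx mx mA nu mu muu ny muy : ℕ}
    (P : TwoStageRO nx mx mA nu mu muu ny muy)
    (hRHS : P.RHSDependent)
    (hA1 : P.NonemptyUncertainty) (hA2 : P.BoundedUncertainty) (hA3 : P.MonolithicBounded) :
    ∃ M₀ : ℝ, ∀ M : ℝ, M₀ ≤ M →
      ∀ (T : ℕ) (it : ℕ → TwoStageRO.Iteration nx mx nu mu muu ny muy), P.IsRun M T it →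
        (∀ (t₁ t₂ : ℕ) (rec₁ rec₂ : TwoStageRO.Cut mu muy → Set (Finset (Fin nu ⊕ Fin muu))),
          1 ≤ t₁ → t₁ < t₂ → t₂ ≤ T →
          P.IsBasisRecord M it t₁ rec₁ → P.IsBasisRecord M it t₂ rec₂ →
          TwoStageRO.scenarios it t₁ = TwoStageRO.scenarios it t₂ →
          (∀ ud ∈ TwoStageRO.scenarios it t₁,
            TwoStageRO.basisCollection it t₁ rec₁ ud = TwoStageRO.basisCollection it t₂ rec₂ ud) →
          P.Stops it t₂ ∧ P.IsOptimal (it t₁).sol.x) ∧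
        (P.X.Nonempty → (∀ t, 1 ≤ t → t ≤ T → ¬ P.Stops it t) →
          T + 1 ≤ P.Ud.card * 2 ^ (nu + muu).choose muu) := by
  rcases P.X.eq_empty_or_nonempty with hX | ⟨x₀, hx₀⟩
  -- With `X` empty no iteration has a feasible master problem, so any `M₀` will do.
  · refine ⟨0, fun M _ T it hrun => ⟨fun t₁ t₂ _ _ h1 h12 h2 _ _ _ _ => ?_, fun h => ?_⟩⟩
    · have := (hrun t₁ h1 (h12.le.trans h2)).1.1.1
      simp [hX] at this
    · simp [hX] at h
  · obtain ⟨M₀, hM₀⟩ := TwoStageRO.exists_exactPenalty hRHS hA1 hA2 hx₀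
    exact ⟨M₀, fun M hM T it hrun => ⟨fun t₁ t₂ rec₁ rec₂ h1 h12 h2 hr₁ hr₂ hsc hb =>
      hrun.stops_and_isOptimal_of_bases_eq hRHS hA3 (hM₀ M hM) h1 h12 h2 hr₁ hr₂ hsc hb,
      hrun.card_bound hRHS hA1 hA2 (hM₀ M hM)⟩⟩
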